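/- Consider a discrete memoryless two-user multiple-access channel $p(y|x_1,x_2)$ with finite alphabets. Logarithms are natural. **Variable length codes.** An $(M_1,M_2,N_1,N_2)$ variable length code consists of encoders $w_i\mapsto (x_{i1}(w_i),x_{i2}(w_i),\dots)$, $w_i\in\{1,\dots,M_i\}$, $i=1,2$, of stopping times $N_1,N_2$ of the received sequence $(Y_k)_{k\ge1}$, and of decoders $g_i$ that are functions of $Y_1,\dots,Y_{N_i}$. The messages $(W_1,W_2)$ are uniform, $P_e=\Pr\{g_1(Y^{N_1})\ne W_1\text{ or }g_2(Y^{N_2})\neq W_2\}$, and $N=\min(N_1,N_2)$. A randomized code chooses at random one code from a finite list of codes with the same $(M_1,M_2)$, the choice being known to both transmitters and to the receiver; expectations and $P_e$ are then also averaged over the choice. A pair $(R_1,R_2)$ is *achievable* by a class of codes with ratios $(r_1,r_2)$ if for every $\epsilon>0$ the class contains a code with $0<E[N_i]<\infty$, $E[N]/E[N_i]\ge r_i$, $\log M_i/E[N_i]\ge R_i$ for $i=1,2$, and $P_e<\epsilon$; $\mathcal C_{r_1,r_2}$ is the set of pairs so achievable by the class of all deterministic codes. **Regions.** Let $C_1=\max_{p(x_1)p(x_2)}I(X_1;Y|X_2)$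 and $C_2=\max_{p(x_1)p(x_2)}I(X_2;Y|X_1)$. For $p(q)p(x_1|q)p(x_2|q)p(y|x_1,x_2)$ with $|\mathcal Q|\le2$ write $I_1=I(X_1;Y|X_2,Q)$, $I_2=I(X_2;Y|X_1,Q)$, $I_{12}=I(X_1,X_2;Y|Q)$. Let $\mathcal R_{MAC}$ be the set of pairs $R_1,R_2\ge0$ such that $R_1\le I_1$, $R_2\le I_2$, $R_1+R_2\le I_{12}$ for some such distribution. For $r_1,r_2\in[0,1]$ let $\mathcal O_{r_1,r_2}$ be the set of pairs $R_1,R_2\ge 0$ such that, for some such distribution, $$R_1\le r_1I_1+(1-r_1)C_1,\qquad R_2\le r_2I_2+(1-r_2)C_2,$$ $$r_2R_1+r_1R_2\le r_1r_2I_{12}+r_2(1-r_1)C_1+r_1(1-r_2)C_2 .$$ **Concatenated codes.** A code $\mathcal V^1$ is the concatenation of a first block code of length $m$ and a second block code of length $n\ge0$ (codewords are then continued by arbitrary fixed letters). In the second block transmitter 1 has a single message and repeats one input symbol. Message 1 is decoded at time $N_1=m$ from the first block, and message 2, a pair of messages (one for each block), at time $N_2=m+n$, in each case by the block decoders. A code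 $\mathcal V^2$ is the same with the two users exchanged. The second block code of $\mathcal V^1$ has rates $(0,C_2-\eta)$ up to a given $\eta>0$ if the rate of user 2 in it lies in $[C_2-\eta,C_2]$ (no condition if $n=0$), and similarly, with $C_1$, for $\mathcal V^2$. **Theorem.** 1. Let $r_2\in[0,1]$. Every $(R_1,R_2)\in\mathcal O_{1,r_2}$ lies in the closure of $\mathcal C_{1,r_2}$. Moreover, for all $\eta>0$ and $n_0$, it lies in the closure of the set of pairs achievable, with ratios $(1,r_2)$, by codes $\mathcal V^1$ whose first block code has length $m>n_0$ and rate pair in $\mathcal R_{MAC}$ and whose second block code has rates $(0,C_2-\eta)$ up to $\eta$. Symmetrically, for $r_1\in[0,1]$, the same holds for $\mathcal O_{r_1,1}$, $\mathcal C_{r_1,1}$ and codes $\mathcal V^2$. 2. Let $C_1,C_2>0$ and let $\mathcal R_{MAC}$ be the (possibly degenerate) pentagon $\{0\le R_1\le C_1,\ 0\le R_2\le C_2,\ R_1+R_2\le C_1+d_2\}$, where $0\le d_i\le C_i$ and $C_1+d_2=d_1+C_2$, so that $(C_1,d_2)$ and $(d_1,C_2)$ are the corner points of its dominant face. Let $\mathcal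 P$ be the set of pairs $R_1,R_2\ge0$ such that for some $p\in[0,1]$, with $\bar p=1-p$, $$R_1\le\frac{C_1}{1+\bar p\,(1-d_1/C_1)},\qquad R_2\le\frac{C_2}{1+p\,(1-d_2/C_2)} .$$ Let $\eta>0$, $n_0\in\mathbb N$ and $\tau\ge0$, where $\tau=0$ is allowed only if there are integers $a,b\ge2$ with $\log a/C_1=\log b/C_2$. Consider the randomized codes that use a code $\mathcal V^1$ with some probability $\lambda\in[0,1]$ and a code $\mathcal V^2$ with probability $1-\lambda$, both with the same $M_1$ and the same $M_2$, where $|\log M_1/C_1-\log M_2/C_2|\le\tau$, the first block codes have lengths greater than $n_0$ and rate pairs $(R_1^*,R_2^*)\in\mathcal R_{MAC}$ with $R_1^*\ge C_1-\eta$, $R_2^*\ge d_2-\eta$ for $\mathcal V^1$ and with $R_1^*\ge d_1-\eta$, $R_2^*\ge C_2-\eta$ for $\mathcal V^2$, and the second block codes have rates $(0,C_2-\eta)$, respectively $(C_1-\eta,0)$, up to $\eta$. Then $\mathcal P$ is contained in the closure of the set of pairs $(R_1,R_2)$ that are achievable by this class with ratios $(R_1/C_1,R_2/C_2)$. If $d_1<C_1$,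 the set $\mathcal P$ is not convex. -/

import Mathlib

open MeasureTheory
open scoped ENNReal NNReal unitInterval

namespace MAC

noncomputable section

/-! ## Information quantities (natural logarithms) -/

/-- Conditional mutual information `I(A;B|C)` of a triple of finite random variables with joint
probability mass function `p a b c`. Terms with `p a b c = 0` contribute `0`. -/
def condMutualInfo {A B C : Type*} [Fintype A] [Fintype B] [Fintype C] (p : A → B → C → ℝ) : ℝ :=
  ∑ a, ∑ b, ∑ c, p a b c *
    Real.log ((p a b c * ∑ a', ∑ b', p a' b' c) / ((∑ b', p a b' c) * ∑ a', p a' b c))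

/-- An input distribution `p(q) p(x₁|q) p(x₂|q)`. -/
structure InputDist (Q X₁ X₂ : Type*) where
  pQ : PMF Q
  p₁ : Q → PMF X₁
  p₂ : Q → PMF X₂

section Region

variable {Q X₁ X₂ Y : Type*} [Fintype Q] [Fintype X₁] [Fintype X₂] [Fintype Y]

/-- The joint mass function `p(q) p(x₁|q) p(x₂|q) p(y|x₁,x₂)`. -/
def InputDist.joint (p : InputDist Q X₁ X₂) (W : X₁ → X₂ → PMF Y)
    (q : Q) (x₁ : X₁) (x₂ : X₂) (y : Y) : ℝ :=
  (p.pQ q).toReal * (p.p₁ q x₁).toReal * (p.p₂ q x₂).toReal * (W x₁ x₂ y).toReal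

/-- `I(X₁;Y|X₂,Q)`. -/
def InputDist.info₁ (p : InputDist Q X₁ X₂) (W : X₁ → X₂ → PMF Y) : ℝ :=
  condMutualInfo fun (x₁ : X₁) (y : Y) (c : X₂ × Q) => p.joint W c.2 x₁ c.1 y

/-- `I(X₂;Y|X₁,Q)`. -/
def InputDist.info₂ (p : InputDist Q X₁ X₂) (W : X₁ → X₂ → PMF Y) : ℝ :=
  condMutualInfo fun (x₂ : X₂) (y : Y) (c : X₁ × Q) => p.joint W c.2 c.1 x₂ y

/-- `I(X₁,X₂;Y|Q)`. -/
def InputDist.info₁₂ (p : InputDist Q X₁ X₂) (W : X₁ → X₂ → PMF Y) : ℝ :=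
  condMutualInfo fun (x : X₁ × X₂) (y : Y) (q : Q) => p.joint W q x.1 x.2 y

/-- `C₁ = max I(X₁;Y|X₂)` over product input distributions `p(x₁) p(x₂)`
(no time sharing: `Q` is trivial). -/
def cap₁ (W : X₁ → X₂ → PMF Y) : ℝ := ⨆ p : InputDist Unit X₁ X₂, p.info₁ W

/-- `C₂ = max I(X₂;Y|X₁)` over product input distributions `p(x₁) p(x₂)`. -/
def cap₂ (W : X₁ → X₂ → PMF Y) : ℝ := ⨆ p : InputDist Unit X₁ X₂, p.info₂ W

/-- The block code capacity region `R_MAC` of the multiple-access channel, with `|Q| ≤ 2`. -/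
def regionMAC (W : X₁ → X₂ → PMF Y) : Set (ℝ × ℝ) :=
  {R | 0 ≤ R.1 ∧ 0 ≤ R.2 ∧ ∃ p : InputDist (Fin 2) X₁ X₂,
    R.1 ≤ p.info₁ W ∧ R.2 ≤ p.info₂ W ∧ R.1 + R.2 ≤ p.info₁₂ W}

/-- The outer region for the ratios `r₁, r₂`. With `s = r₂ / r₁`, the last inequality is
`s R₁ + R₂ ≤ r₂ I(X₁,X₂;Y|Q) + s (1 - r₁) C₁ + (1 - r₂) C₂` multiplied by `r₁`, which also makes
sense for `r₁ = 0`. -/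
def outerRegion (W : X₁ → X₂ → PMF Y) (r₁ r₂ : ℝ) : Set (ℝ × ℝ) :=
  {R | 0 ≤ R.1 ∧ 0 ≤ R.2 ∧ ∃ p : InputDist (Fin 2) X₁ X₂,
    R.1 ≤ r₁ * p.info₁ W + (1 - r₁) * cap₁ W ∧
    R.2 ≤ r₂ * p.info₂ W + (1 - r₂) * cap₂ W ∧
    r₂ * R.1 + r₁ * R.2 ≤
      r₁ * r₂ * p.info₁₂ W + r₂ * (1 - r₁) * cap₁ W + r₁ * (1 - r₂) * cap₂ W}

/-- `R_MAC` is a (possibly degenerate) pentagon, the corner points of its dominant face being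
`(C₁, d₂)` and `(d₁, C₂)`. -/
def IsPentagon (W : X₁ → X₂ → PMF Y) (d₁ d₂ : ℝ) : Prop :=
  0 ≤ d₁ ∧ d₁ ≤ cap₁ W ∧ 0 ≤ d₂ ∧ d₂ ≤ cap₂ W ∧ d₁ + cap₂ W = cap₁ W + d₂ ∧
  regionMAC W = {R | 0 ≤ R.1 ∧ R.1 ≤ cap₁ W ∧ 0 ≤ R.2 ∧ R.2 ≤ cap₂ W ∧ R.1 + R.2 ≤ cap₁ W + d₂}

/-- The outer region in the pentagon case with `log M₁ / C₁ = log M₂ / C₂`. -/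
def pentagonOuterRegion (W : X₁ → X₂ → PMF Y) (d₁ d₂ : ℝ) : Set (ℝ × ℝ) :=
  {R | 0 ≤ R.1 ∧ 0 ≤ R.2 ∧ ∃ p ∈ Set.Icc (0 : ℝ) 1,
    R.1 ≤ cap₁ W / (1 + (1 - p) * (1 - d₁ / cap₁ W)) ∧
    R.2 ≤ cap₂ W / (1 + p * (1 - d₂ / cap₂ W))}

end Region

/-! ## Variable length codes -/

/-- `N` is a stopping time for the received sequence: whether `N ≤ n` holds is determined by the
first `n` received letters. -/
def IsStoppingRule {Y : Type*} (N : (ℕ → Y) → ℕ∞) : Prop :=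
  ∀ (n : ℕ) (y y' : ℕ → Y), (∀ i < n, y i = y' i) → (N y ≤ n ↔ N y' ≤ n)

/-- An `(M₁, M₂, N₁, N₂)` variable length code. Letter number `i` of a sequence has index `i - 1`.
The decoders depend on the received sequence up to their decoding time only. -/
structure VLCode (X₁ X₂ Y : Type*) (M₁ M₂ : ℕ) where
  enc₁ : Fin M₁ → ℕ → X₁
  enc₂ : Fin M₂ → ℕ → X₂
  N₁ : (ℕ → Y) → ℕ∞
  N₂ : (ℕ → Y) → ℕ∞
  dec₁ : (ℕ → Y) → Fin M₁
  dec₂ : (ℕ → Y) → Fin M₂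
  stop₁ : IsStoppingRule N₁
  stop₂ : IsStoppingRule N₂
  adapted₁ : ∀ y y' : ℕ → Y, (∀ i : ℕ, (i : ℕ∞) < N₁ y → y i = y' i) → dec₁ y = dec₁ y'
  adapted₂ : ∀ y y' : ℕ → Y, (∀ i : ℕ, (i : ℕ∞) < N₂ y → y i = y' i) → dec₂ y = dec₂ y'

namespace VLCode

variable {X₁ X₂ Y : Type*} {M₁ M₂ : ℕ} [MeasurableSpace Y]

/-- The law of the received sequence when the message pair `(w₁, w₂)` is sent
(memoryless channel). -/
def law (V : VLCode X₁ X₂ Y M₁ M₂) (W : X₁ → X₂ → PMF Y) (w₁ : Fin M₁) (w₂ : Fin M₂) :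
    Measure (ℕ → Y) :=
  Measure.infinitePi fun i => (W (V.enc₁ w₁ i) (V.enc₂ w₂ i)).toMeasure

/-- The expectation of a function of the received sequence, over the channel and the uniformly
distributed message pair. -/
def mean (V : VLCode X₁ X₂ Y M₁ M₂) (W : X₁ → X₂ → PMF Y) (T : (ℕ → Y) → ℕ∞) : ℝ≥0∞ :=
  (∑ w₁, ∑ w₂, ∫⁻ y, ((T y : ℕ∞) : ℝ≥0∞) ∂(V.law W w₁ w₂)) / ((M₁ : ℝ≥0∞) * (M₂ : ℝ≥0∞))

/-- The average probability that the decoded message pair differs from the transmitted one. -/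
def errorProb (V : VLCode X₁ X₂ Y M₁ M₂) (W : X₁ → X₂ → PMF Y) : ℝ :=
  (∑ w₁, ∑ w₂, (V.law W w₁ w₂).real {y | V.dec₁ y ≠ w₁ ∨ V.dec₂ y ≠ w₂}) / ((M₁ : ℝ) * (M₂ : ℝ))

end VLCode

/-- A variable length code with randomly chosen codebook: code number `k` is used with probability
`prob k`; the outcome of the choice is known to the transmitters and to the receiver. -/
structure RandVLCode (X₁ X₂ Y : Type*) (M₁ M₂ : ℕ) where
  K : ℕ
  prob : Fin K → ℝ≥0
  prob_sum : ∑ k, prob k = 1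
  code : Fin K → VLCode X₁ X₂ Y M₁ M₂

/-- A deterministic variable length code. -/
def VLCode.det {X₁ X₂ Y : Type*} {M₁ M₂ : ℕ} (V : VLCode X₁ X₂ Y M₁ M₂) :
    RandVLCode X₁ X₂ Y M₁ M₂ where
  K := 1
  prob := fun _ => 1
  prob_sum := by simp
  code := fun _ => V

/-- Alternation: `V` is used with probability `t` and `V'` with probability `1 - t`. -/
def VLCode.alternate {X₁ X₂ Y : Type*} {M₁ M₂ : ℕ} (t : I) (V V' : VLCode X₁ X₂ Y M₁ M₂) :
    RandVLCode X₁ X₂ Y M₁ M₂ where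
  K := 2
  prob := ![unitInterval.toNNReal t, unitInterval.toNNReal (unitInterval.symm t)]
  prob_sum := by
    apply NNReal.eq
    rw [Fin.sum_univ_two]
    exact add_sub_cancel (t : ℝ) 1
  code := ![V, V']

namespace RandVLCode

variable {X₁ X₂ Y : Type*} {M₁ M₂ : ℕ} [MeasurableSpace Y]

/-- `E[N₁]`. -/
def meanN₁ (V : RandVLCode X₁ X₂ Y M₁ M₂) (W : X₁ → X₂ → PMF Y) : ℝ≥0∞ :=
  ∑ k, (V.prob k : ℝ≥0∞) * (V.code k).mean W (V.code k).N₁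

/-- `E[N₂]`. -/
def meanN₂ (V : RandVLCode X₁ X₂ Y M₁ M₂) (W : X₁ → X₂ → PMF Y) : ℝ≥0∞ :=
  ∑ k, (V.prob k : ℝ≥0∞) * (V.code k).mean W (V.code k).N₂

/-- `E[N]`, where `N = min(N₁, N₂)`. -/
def meanN (V : RandVLCode X₁ X₂ Y M₁ M₂) (W : X₁ → X₂ → PMF Y) : ℝ≥0∞ :=
  ∑ k, (V.prob k : ℝ≥0∞) * (V.code k).mean W fun y => min ((V.code k).N₁ y) ((V.code k).N₂ y)

/-- The average probability of error. -/
def errorProb (V : RandVLCode X₁ X₂ Y M₁ M₂) (W : X₁ → X₂ → PMF Y) : ℝ :=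
  ∑ k, (V.prob k : ℝ) * (V.code k).errorProb W

end RandVLCode

/-- The rate pairs achievable by codes of the family `S` that satisfy `E[N]/E[N₁] ≥ r₁` and
`E[N]/E[N₂] ≥ r₂`. The expected decoding times are required to be positive and finite, so that
rates and ratios are genuine quotients. -/
def achievableBy {X₁ X₂ Y : Type*} [MeasurableSpace Y] (W : X₁ → X₂ → PMF Y)
    (S : ∀ M₁ M₂ : ℕ, Set (RandVLCode X₁ X₂ Y M₁ M₂)) (r₁ r₂ : ℝ) : Set (ℝ × ℝ) :=
  {R | ∀ ε > 0, ∃ (M₁ M₂ : ℕ), ∃ V ∈ S M₁ M₂,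
    V.meanN₁ W ≠ 0 ∧ V.meanN₁ W ≠ ⊤ ∧ V.meanN₂ W ≠ 0 ∧ V.meanN₂ W ≠ ⊤ ∧
    r₁ ≤ (V.meanN W).toReal / (V.meanN₁ W).toReal ∧
    r₂ ≤ (V.meanN W).toReal / (V.meanN₂ W).toReal ∧
    R.1 ≤ Real.log M₁ / (V.meanN₁ W).toReal ∧
    R.2 ≤ Real.log M₂ / (V.meanN₂ W).toReal ∧
    V.errorProb W < ε}

/-- The region `𝒞_{r₁,r₂}`: rate pairs achievable by (deterministic) variable length codes with
`E[N]/E[N₁] ≥ r₁` and `E[N]/E[N₂] ≥ r₂`. -/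
def achievableRegion {X₁ X₂ Y : Type*} [MeasurableSpace Y] (W : X₁ → X₂ → PMF Y) (r₁ r₂ : ℝ) :
    Set (ℝ × ℝ) :=
  achievableBy W (fun _ _ => Set.range VLCode.det) r₁ r₂

/-! ## Concatenation of block codes -/

/-- A block code of length `n` for the multiple-access channel. -/
structure BlockCode (X₁ X₂ Y : Type*) (M₁ M₂ n : ℕ) where
  enc₁ : Fin M₁ → Fin n → X₁
  enc₂ : Fin M₂ → Fin n → X₂
  dec₁ : (Fin n → Y) → Fin M₁
  dec₂ : (Fin n → Y) → Fin M₂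

/-- The word `u` followed by the word `v`, then an infinite sequence of `pad`. -/
def concatWord {X : Type*} {m n : ℕ} (u : Fin m → X) (v : Fin n → X) (pad : X) (i : ℕ) : X :=
  if h : i < m then u ⟨i, h⟩ else if h' : i - m < n then v ⟨i - m, h'⟩ else pad

/-- The block of `n` letters of `y` that follows the first `m` letters. -/
def block {Y : Type*} (m n : ℕ) (y : ℕ → Y) : Fin n → Y := fun i => y (m + i)

theorem isStoppingRule_const {Y : Type*} (n : ℕ) :
    IsStoppingRule (fun _ : ℕ → Y => (n : ℕ∞)) := fun _ _ _ _ => Iff.rfl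

theorem block_congr {Y : Type*} {m n k : ℕ} (hk : m + n ≤ k) {y y' : ℕ → Y}
    (h : ∀ i : ℕ, (i : ℕ∞) < (k : ℕ∞) → y i = y' i) : block m n y = block m n y' := by
  funext i
  exact h _ (by exact_mod_cast (by omega : m + (i : ℕ) < k))

/-- The code `V¹`: the block code `B`, of length `m`, followed by the block code `B'`, of length
`n`, in which transmitter 1 sends no information. The second message is a pair of messages, one for
each block (through `e`). Message 1 is decoded at time `m`, message 2 at time `m + n`. -/
def concat₁ {X₁ X₂ Y : Type*} {M₁ M₂ K L m n : ℕ} (B : BlockCode X₁ X₂ Y M₁ K m)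
    (B' : BlockCode X₁ X₂ Y 1 L n) (e : Fin M₂ ≃ Fin K × Fin L) (pad₁ : X₁) (pad₂ : X₂) :
    VLCode X₁ X₂ Y M₁ M₂ where
  enc₁ := fun w => concatWord (B.enc₁ w) (B'.enc₁ 0) pad₁
  enc₂ := fun w => concatWord (B.enc₂ (e w).1) (B'.enc₂ (e w).2) pad₂
  N₁ := fun _ => (m : ℕ)
  N₂ := fun _ => (m + n : ℕ)
  dec₁ := fun y => B.dec₁ (block 0 m y)
  dec₂ := fun y => e.symm (B.dec₂ (block 0 m y), B'.dec₂ (block m n y))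
  stop₁ := isStoppingRule_const m
  stop₂ := isStoppingRule_const (m + n)
  adapted₁ := fun y y' h => by rw [block_congr (by omega) h]
  adapted₂ := fun y y' h => by
    rw [block_congr (m := 0) (n := m) (by omega) h, block_congr (m := m) (n := n) le_rfl h]

/-- The code `V²`, symmetric to `V¹`: transmitter 2 sends no information in the second block,
message 2 is decoded at time `m` and message 1 at time `m + n`. -/
def concat₂ {X₁ X₂ Y : Type*} {M₁ M₂ K L m n : ℕ} (B : BlockCode X₁ X₂ Y K M₂ m)
    (B' : BlockCode X₁ X₂ Y L 1 n) (e : Fin M₁ ≃ Fin K × Fin L) (pad₁ : X₁) (pad₂ : X₂) :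
    VLCode X₁ X₂ Y M₁ M₂ where
  enc₁ := fun w => concatWord (B.enc₁ (e w).1) (B'.enc₁ (e w).2) pad₁
  enc₂ := fun w => concatWord (B.enc₂ w) (B'.enc₂ 0) pad₂
  N₁ := fun _ => (m + n : ℕ)
  N₂ := fun _ => (m : ℕ)
  dec₁ := fun y => e.symm (B.dec₁ (block 0 m y), B'.dec₁ (block m n y))
  dec₂ := fun y => B.dec₂ (block 0 m y)
  stop₁ := isStoppingRule_const (m + n)
  stop₂ := isStoppingRule_const m
  adapted₁ := fun y y' h => by
    rw [block_congr (m := 0) (n := m) (by omega) h, block_congr (m := m) (n := n) le_rfl h]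
  adapted₂ := fun y y' h => by rw [block_congr (by omega) h]

section Families

variable {X₁ X₂ Y : Type*} [Fintype X₁] [Fintype X₂] [Fintype Y]

/-- The codes `V¹` whose first block code has length `m > n₀` and its rate pair in `T`, and whose
second block code has rates `(0, R)` with `C₂ - η ≤ R ≤ C₂`, transmitter 1 repeating one fixed
input symbol during the second block. The second block may be empty. -/
def concatCodes₁ (W : X₁ → X₂ → PMF Y) (T : Set (ℝ × ℝ)) (η : ℝ) (n₀ M₁ M₂ : ℕ) :
    Set (VLCode X₁ X₂ Y M₁ M₂) :=
  {V | ∃ (K L m n : ℕ) (B : BlockCode X₁ X₂ Y M₁ K m) (B' : BlockCode X₁ X₂ Y 1 L n)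
      (e : Fin M₂ ≃ Fin K × Fin L) (pad₁ : X₁) (pad₂ : X₂),
    n₀ < m ∧ (Real.log M₁ / m, Real.log K / m) ∈ T ∧
    n * (cap₂ W - η) ≤ Real.log L ∧ Real.log L ≤ n * cap₂ W ∧
    (∃ x, ∀ i, B'.enc₁ 0 i = x) ∧ V = concat₁ B B' e pad₁ pad₂}

/-- The codes `V²`, symmetric to `concatCodes₁`. -/
def concatCodes₂ (W : X₁ → X₂ → PMF Y) (T : Set (ℝ × ℝ)) (η : ℝ) (n₀ M₁ M₂ : ℕ) :
    Set (VLCode X₁ X₂ Y M₁ M₂) :=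
  {V | ∃ (K L m n : ℕ) (B : BlockCode X₁ X₂ Y K M₂ m) (B' : BlockCode X₁ X₂ Y L 1 n)
      (e : Fin M₁ ≃ Fin K × Fin L) (pad₁ : X₁) (pad₂ : X₂),
    n₀ < m ∧ (Real.log K / m, Real.log M₂ / m) ∈ T ∧
    n * (cap₁ W - η) ≤ Real.log L ∧ Real.log L ≤ n * cap₁ W ∧
    (∃ x, ∀ i, B'.enc₂ 0 i = x) ∧ V = concat₂ B B' e pad₁ pad₂}

/-- Random alternation between a code `V¹` whose first block code has a rate pair within `η` of the
corner point `(C₁, d₂)` and a code `V²` whose first block code has a rate pair within `η` of the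
corner point `(d₁, C₂)` (from below), the message set sizes satisfying
`log M₁ / C₁ = log M₂ / C₂` up to the tolerance `τ` (exactly, if `τ = 0`). -/
def alternatingCodes (W : X₁ → X₂ → PMF Y) (d₁ d₂ η τ : ℝ) (n₀ M₁ M₂ : ℕ) :
    Set (RandVLCode X₁ X₂ Y M₁ M₂) :=
  {V | |Real.log M₁ / cap₁ W - Real.log M₂ / cap₂ W| ≤ τ ∧
    ∃ V₁ ∈ concatCodes₁ W {R ∈ regionMAC W | cap₁ W - η ≤ R.1 ∧ d₂ - η ≤ R.2} η n₀ M₁ M₂,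
    ∃ V₂ ∈ concatCodes₂ W {R ∈ regionMAC W | d₁ - η ≤ R.1 ∧ cap₂ W - η ≤ R.2} η n₀ M₁ M₂,
    ∃ t : I, V = VLCode.alternate t V₁ V₂}

end Families

end

end MAC

set_option linter.unusedSectionVars false

namespace MAC

noncomputable section

open Filter Topology


/-! ## Averages with respect to finite weights -/

section Avg

variable {A ι : Type*} [Fintype A] [Fintype ι] [DecidableEq ι]

/-! The theorem rests on the direct coding theorem for the multiple-access channel and on
bookkeeping of block lengths.

The coding theorem, `InputDist.exists_blockCode`, is proved by random coding: the decoder looks for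
a message pair whose likelihood exceeds three thresholds (`exists_code_of_threshold`). The true pair
fails a threshold with exponentially small probability by a Chernoff bound on the information
density (`InputDist.exists_tail_bound`). A wrong pair passes with probability at most the reciprocal
of a threshold. If one user is silent, `exists_constant_blockCode` gives the other user any rate
below its conditional capacity, with one fixed symbol sent by the silent user. By the union bound
the error of a concatenation is at most the sum of the errors of its two blocks
(`errorProb_concat₁_le`).

For the deterministic part, let message 1 be decoded after the first block and let this block occupy
a fraction `r` of the time `N₂`. User 2 then has the overall rate `r S + (1 - r) C₂`, where `S` is
its rate in the first block. Solving for `S` turns the inequalities of the outer region into those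
of the coding theorem (`exists_concatCodes₁_of_mem_outerRegion`). The ratio `r = 0` is a limit of
positive ratios, and the other order of decoding follows by exchanging the users.

For the pentagon, `V¹` and `V²` work at the two corner points with the same message sets and the
same first length `m`, where `m` is about `log M₁ / C₁` and `log M₂ / C₂`. The second blocks then
have lengths about `m (1 - d₂/C₂)` and `m (1 - d₁/C₁)`. Hence `N = m` always, while `E[N₁]` and
`E[N₂]` are about `m` times the denominators that define `P`. Equality of the message sets is what
needs care: the sizes are powers of integers, so that they split exactly between blocks
(`exists_block_split`), and their logarithms are matched by Dirichlet approximation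
(`exists_matching_powers`). Non-convexity comes from strict convexity of `p ↦ C / (1 + p u)`. -/

/-- The average of `f` with respect to the weights `P`. -/
def avg (P f : A → ℝ) : ℝ := ∑ a, P a * f a

/-- Independent letters, letter `i` having the weights `P i`. -/
def prodWeight (P : ι → A → ℝ) (a : ι → A) : ℝ := ∏ i, P i (a i)

theorem avg_add (P f g : A → ℝ) : avg P (fun a => f a + g a) = avg P f + avg P g := by
  simp only [avg, mul_add, Finset.sum_add_distrib]

theorem avg_sum {κ : Type*} (s : Finset κ) (P : A → ℝ) (f : κ → A → ℝ) :
    avg P (fun a => ∑ k ∈ s, f k a) = ∑ k ∈ s, avg P (f k) := by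
  simp only [avg, Finset.mul_sum]
  exact Finset.sum_comm

theorem avg_comm {B : Type*} [Fintype B] (P : A → ℝ) (Q : B → ℝ) (f : A → B → ℝ) :
    avg P (fun a => avg Q (f a)) = avg Q (fun b => avg P fun a => f a b) := by
  simp only [avg, Finset.mul_sum]
  rw [Finset.sum_comm]
  exact Finset.sum_congr rfl fun b _ => Finset.sum_congr rfl fun a _ => by ring

theorem avg_mono {P f g : A → ℝ} (hP : P ∈ stdSimplex ℝ A) (h : ∀ a, f a ≤ g a) :
    avg P f ≤ avg P g :=
  Finset.sum_le_sum fun a _ => mul_le_mul_of_nonneg_left (h a) (hP.1 a)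

theorem avg_const {P : A → ℝ} (hP : P ∈ stdSimplex ℝ A) (c : ℝ) : avg P (fun _ => c) = c := by
  rw [avg, ← Finset.sum_mul, hP.2, one_mul]

theorem avg_ite (P f : A → ℝ) (g : Prop) [Decidable g] :
    avg P (fun a => if g then f a else 0) = if g then avg P f else 0 := by
  split_ifs <;> simp [avg]

/-- The derandomization step: a good average over codebooks, time-sharing sequences or input letters
yields one good choice. -/
theorem exists_le_of_avg_le {P f : A → ℝ} {c : ℝ} (hP : P ∈ stdSimplex ℝ A)
    (h : avg P f ≤ c) : ∃ a, f a ≤ c := by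
  by_contra! hc
  have h0 : ∀ a ∈ Finset.univ, 0 ≤ P a * (f a - c) := fun a _ =>
    mul_nonneg (hP.1 a) (sub_nonneg.2 (hc a).le)
  have h1 : ∑ a, P a * (f a - c) = avg P f - c := by
    simp only [mul_sub, Finset.sum_sub_distrib, ← Finset.sum_mul, hP.2, one_mul, avg]
  have h2 : ∑ a, P a * (f a - c) = 0 :=
    le_antisymm (by linarith) (Finset.sum_nonneg h0)
  have h3 : ∀ a, P a = 0 := fun a => by
    have := (Finset.sum_eq_zero_iff_of_nonneg h0).1 h2 a (Finset.mem_univ a)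
    exact (mul_eq_zero.1 this).resolve_right (sub_pos.2 (hc a)).ne'
  have := hP.2
  simp [h3] at this

theorem sum_prod_pi (f : ι → A → ℝ) :
    ∑ a : ι → A, ∏ i, f i (a i) = ∏ i, ∑ x, f i x := by
  rw [Finset.prod_univ_sum, Fintype.piFinset_univ]

theorem prodWeight_mem {P : ι → A → ℝ} (hP : ∀ i, P i ∈ stdSimplex ℝ A) :
    prodWeight P ∈ stdSimplex ℝ (ι → A) := by
  refine ⟨fun a => Finset.prod_nonneg fun i _ => (hP i).1 _, ?_⟩
  simp only [prodWeight]
  rw [sum_prod_pi]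
  exact Finset.prod_eq_one fun i _ => (hP i).2

theorem avg_prodWeight_prod (P g : ι → A → ℝ) :
    avg (prodWeight P) (fun a => ∏ i, g i (a i)) = ∏ i, avg (P i) (g i) := by
  simp only [avg, prodWeight, ← Finset.prod_mul_distrib]
  exact sum_prod_pi fun i x => P i x * g i x

theorem avg_prodWeight_apply {P : A → ℝ} (hP : P ∈ stdSimplex ℝ A) (w : ι) (f : A → ℝ) :
    avg (prodWeight fun _ : ι => P) (fun c => f (c w)) = avg P f := by
  have h := avg_prodWeight_prod (fun _ : ι => P) (fun i a => if i = w then f a else 1)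
  simp only [Finset.prod_ite_eq', Finset.mem_univ, if_true] at h
  rw [h, Finset.prod_eq_single w]
  · simp
  · intro i _ hi
    simp only [hi, if_false]
    exact avg_const hP 1
  · simp

theorem avg_prodWeight_apply₂ {P : A → ℝ} (hP : P ∈ stdSimplex ℝ A) {w w' : ι} (hw : w' ≠ w)
    (f : A → A → ℝ) :
    avg (prodWeight fun _ : ι => P) (fun c => f (c w) (c w')) =
      avg P fun a => avg P fun a' => f a a' := by
  classical
  -- Fixing the value `b` of the second letter by an indicator makes the integrand a product over
  -- coordinates; summing over `b` afterwards recovers `f`.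
  have key : ∀ b, avg (prodWeight fun _ : ι => P)
      (fun c => f (c w) b * if c w' = b then 1 else 0) = avg P (fun a => f a b) * P b := by
    intro b
    have h := avg_prodWeight_prod (fun _ : ι => P) (fun i a => if i = w then f a b else
      if i = w' then (if a = b then 1 else 0) else 1)
    have h1 : ∀ g : ι → ℝ, (∀ i, i ≠ w → i ≠ w' → g i = 1) → ∏ i, g i = g w * g w' :=
      fun g hg => by
        rw [← Finset.prod_pair hw.symm]
        exact (Finset.prod_subset (Finset.subset_univ _) fun i _ hi => by
          simp only [Finset.mem_insert, Finset.mem_singleton, not_or] at hi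
          exact hg i hi.1 hi.2).symm
    rw [h1 _ fun i hi hi' => by simp only [hi, hi', if_false]; exact avg_const hP 1] at h
    have h2 : avg P (fun a => if a = b then 1 else 0) = P b := by simp [avg]
    simp only [if_true, hw, if_false] at h
    rw [← h2, ← h]
    congr 1
    funext c
    rw [h1 _ fun i hi hi' => by simp only [hi, hi', if_false]]
    simp [hw]
  have h3 : ∀ c : ι → A, f (c w) (c w') = ∑ b, f (c w) b * if c w' = b then 1 else 0 := by
    intro c; simp
  simp only [h3]
  rw [avg_sum]
  simp only [key]
  rw [avg_comm]
  simp only [avg, Finset.sum_mul, Finset.mul_sum]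
  exact Finset.sum_congr rfl fun _ _ => Finset.sum_congr rfl fun _ _ => by ring

end Avg

/-! ## Random coding -/

section OneShot

variable {A₁ A₂ B : Type*} [Fintype A₁] [Fintype A₂] [Fintype B]

open scoped Classical in
/-- Random coding bound with an arbitrary decoding rule `G`. -/
theorem exists_code_of_rule {M₁ M₂ : ℕ} [NeZero M₁] [NeZero M₂] {P₁ : A₁ → ℝ} {P₂ : A₂ → ℝ}
    (h₁ : P₁ ∈ stdSimplex ℝ A₁) (h₂ : P₂ ∈ stdSimplex ℝ A₂) (W : A₁ → A₂ → B → ℝ)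
    (hW : ∀ a₁ a₂ b, 0 ≤ W a₁ a₂ b) (G : A₁ → A₂ → B → Prop) :
    ∃ (c₁ : Fin M₁ → A₁) (c₂ : Fin M₂ → A₂) (d : B → Fin M₁ × Fin M₂),
      (∑ w₁, ∑ w₂, ∑ b, if d b = (w₁, w₂) then 0 else W (c₁ w₁) (c₂ w₂) b) / (M₁ * M₂ : ℝ) ≤
        (avg P₁ fun a₁ => avg P₂ fun a₂ => ∑ b, if G a₁ a₂ b then 0 else W a₁ a₂ b) +
        (M₁ - 1) * (avg P₁ fun a₁ => avg P₁ fun a₁' => avg P₂ fun a₂ =>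
          ∑ b, if G a₁' a₂ b then W a₁ a₂ b else 0) +
        (M₂ - 1) * (avg P₁ fun a₁ => avg P₂ fun a₂ => avg P₂ fun a₂' =>
          ∑ b, if G a₁ a₂' b then W a₁ a₂ b else 0) +
        (M₁ - 1) * (M₂ - 1) * (avg P₁ fun a₁ => avg P₁ fun a₁' => avg P₂ fun a₂ =>
          avg P₂ fun a₂' => ∑ b, if G a₁' a₂' b then W a₁ a₂ b else 0) := by
  set T₀ : A₁ → A₂ → ℝ := fun a₁ a₂ => ∑ b, if G a₁ a₂ b then 0 else W a₁ a₂ b with hT₀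
  set T₁ : A₁ → A₁ → A₂ → ℝ := fun a₁ a₁' a₂ => ∑ b, if G a₁' a₂ b then W a₁ a₂ b else 0 with hT₁
  set T₂ : A₁ → A₂ → A₂ → ℝ := fun a₁ a₂ a₂' => ∑ b, if G a₁ a₂' b then W a₁ a₂ b else 0 with hT₂
  set T₃ : A₁ → A₁ → A₂ → A₂ → ℝ := fun a₁ a₁' a₂ a₂' =>
    ∑ b, if G a₁' a₂' b then W a₁ a₂ b else 0 with hT₃
  -- Any pair accepted by `G` may be chosen, uniqueness being irrelevant: an error forces either
  -- that the true pair is rejected or that some wrong pair is accepted. The value `(0, 0)` is a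
  -- mere default.
  set d : (Fin M₁ → A₁) → (Fin M₂ → A₂) → B → Fin M₁ × Fin M₂ := fun c₁ c₂ b =>
    if h : ∃ w : Fin M₁ × Fin M₂, G (c₁ w.1) (c₂ w.2) b then h.choose else (0, 0) with hd
  set D : ℝ := (avg P₁ fun a₁ => avg P₂ fun a₂ => T₀ a₁ a₂) +
        (M₁ - 1) * (avg P₁ fun a₁ => avg P₁ fun a₁' => avg P₂ fun a₂ => T₁ a₁ a₁' a₂) +
        (M₂ - 1) * (avg P₁ fun a₁ => avg P₂ fun a₂ => avg P₂ fun a₂' => T₂ a₁ a₂ a₂') +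
        (M₁ - 1) * (M₂ - 1) * (avg P₁ fun a₁ => avg P₁ fun a₁' => avg P₂ fun a₂ =>
          avg P₂ fun a₂' => T₃ a₁ a₁' a₂ a₂') with hD
  set e : (Fin M₁ → A₁) → (Fin M₂ → A₂) → Fin M₁ → Fin M₂ → ℝ := fun c₁ c₂ w₁ w₂ =>
    ∑ b, if d c₁ c₂ b = (w₁, w₂) then 0 else W (c₁ w₁) (c₂ w₂) b with he
  -- Union bound, with the wrong pairs sorted by whether the first message, the second or both are
  -- wrong.
  have hpt : ∀ c₁ c₂ w₁ w₂, e c₁ c₂ w₁ w₂ ≤ T₀ (c₁ w₁) (c₂ w₂) +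
      ∑ w₁' ∈ Finset.univ.erase w₁, T₁ (c₁ w₁) (c₁ w₁') (c₂ w₂) +
      ∑ w₂' ∈ Finset.univ.erase w₂, T₂ (c₁ w₁) (c₂ w₂) (c₂ w₂') +
      ∑ w₁' ∈ Finset.univ.erase w₁, ∑ w₂' ∈ Finset.univ.erase w₂,
        T₃ (c₁ w₁) (c₁ w₁') (c₂ w₂) (c₂ w₂') := by
    intro c₁ c₂ w₁ w₂
    simp only [he, hT₀, hT₁, hT₂, hT₃]
    rw [Finset.sum_comm (s := Finset.univ.erase w₁) (t := (Finset.univ : Finset B)),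
      Finset.sum_comm (s := Finset.univ.erase w₂) (t := (Finset.univ : Finset B))]
    have hc : ∀ w₁' : Fin M₁, ∑ w₂' ∈ Finset.univ.erase w₂, ∑ b,
        (if G (c₁ w₁') (c₂ w₂') b then W (c₁ w₁) (c₂ w₂) b else 0) =
        ∑ b, ∑ w₂' ∈ Finset.univ.erase w₂,
        (if G (c₁ w₁') (c₂ w₂') b then W (c₁ w₁) (c₂ w₂) b else 0) := fun _ => Finset.sum_comm
    simp only [hc]
    rw [Finset.sum_comm (s := Finset.univ.erase w₁) (t := (Finset.univ : Finset B)),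
      ← Finset.sum_add_distrib,
      ← Finset.sum_add_distrib, ← Finset.sum_add_distrib]
    refine Finset.sum_le_sum fun b _ => ?_
    set x := W (c₁ w₁) (c₂ w₂) b
    have hx : 0 ≤ x := hW _ _ _
    have n0 : 0 ≤ (if G (c₁ w₁) (c₂ w₂) b then 0 else x) := by split_ifs <;> simp [hx]
    have n1 : ∀ w₁' w₂', 0 ≤ (if G (c₁ w₁') (c₂ w₂') b then x else 0) := by
      intro _ _; split_ifs <;> simp [hx]
    have s1 := Finset.sum_nonneg fun w₁' (_ : w₁' ∈ Finset.univ.erase w₁) => n1 w₁' w₂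
    have s2 := Finset.sum_nonneg fun w₂' (_ : w₂' ∈ Finset.univ.erase w₂) => n1 w₁ w₂'
    have n2 := fun w₁' => Finset.sum_nonneg
      fun w₂' (_ : w₂' ∈ Finset.univ.erase w₂) => n1 w₁' w₂'
    have s3 := Finset.sum_nonneg fun w₁' (_ : w₁' ∈ Finset.univ.erase w₁) => n2 w₁'
    by_cases hdb : d c₁ c₂ b = (w₁, w₂)
    · rw [if_pos hdb]; linarith
    rw [if_neg hdb]
    by_cases hG : G (c₁ w₁) (c₂ w₂) b
    swap
    · rw [if_neg hG]; linarith
    have hex : ∃ w : Fin M₁ × Fin M₂, G (c₁ w.1) (c₂ w.2) b := ⟨(w₁, w₂), hG⟩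
    have hsp := hex.choose_spec
    have hdd : d c₁ c₂ b = hex.choose := by simp only [hd]; rw [dif_pos hex]
    rw [← hdd] at hsp
    rcases hv : d c₁ c₂ b with ⟨v₁, v₂⟩
    rw [hv] at hdb hsp
    simp only [Prod.mk.injEq] at hdb
    dsimp only at hsp
    by_cases h1 : v₁ = w₁
    · have h2 : v₂ ≠ w₂ := fun h => hdb ⟨h1, h⟩
      have := Finset.single_le_sum (f := fun w₂' => if G (c₁ w₁) (c₂ w₂') b then x else 0)
        (fun w₂' _ => n1 w₁ w₂') (Finset.mem_erase.2 ⟨h2, Finset.mem_univ v₂⟩)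
      simp only [← h1, hsp, if_true] at this
      simp only [← h1] at *
      linarith
    by_cases h2 : v₂ = w₂
    · have := Finset.single_le_sum (f := fun w₁' => if G (c₁ w₁') (c₂ w₂) b then x else 0)
        (fun w₁' _ => n1 w₁' w₂) (Finset.mem_erase.2 ⟨h1, Finset.mem_univ v₁⟩)
      simp only [← h2, hsp, if_true] at this
      simp only [← h2] at *
      linarith
    · have t1 := Finset.single_le_sum (f := fun w₂' => if G (c₁ v₁) (c₂ w₂') b then x else 0)
        (fun w₂' _ => n1 v₁ w₂') (Finset.mem_erase.2 ⟨h2, Finset.mem_univ v₂⟩)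
      have t2 := Finset.single_le_sum (f := fun w₁' => ∑ w₂' ∈ Finset.univ.erase w₂,
        if G (c₁ w₁') (c₂ w₂') b then x else 0)
        (fun w₁' _ => n2 w₁') (Finset.mem_erase.2 ⟨h1, Finset.mem_univ v₁⟩)
      simp only [hsp, if_true] at t1 t2
      linarith
  have hcard : ∀ (M : ℕ) [NeZero M] (w : Fin M),
      ((Finset.univ.erase w).card : ℝ) = (M : ℝ) - 1 := by
    intro M _ w
    rw [Finset.card_erase_of_mem (Finset.mem_univ _), Finset.card_univ, Fintype.card_fin,
      Nat.cast_sub (Nat.one_le_iff_ne_zero.2 (NeZero.ne M)), Nat.cast_one]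
  have m₁ : (prodWeight fun _ : Fin M₁ => P₁) ∈ stdSimplex ℝ _ := prodWeight_mem fun _ => h₁
  have m₂ : (prodWeight fun _ : Fin M₂ => P₂) ∈ stdSimplex ℝ _ := prodWeight_mem fun _ => h₂
  -- Codewords are drawn independently, so a wrong codeword is an independent copy of the true one;
  -- only the number of wrong messages enters.
  have hmean : ∀ w₁ w₂, (avg (prodWeight fun _ : Fin M₁ => P₁) fun c₁ =>
      avg (prodWeight fun _ : Fin M₂ => P₂) fun c₂ => e c₁ c₂ w₁ w₂) ≤ D := by
    intro w₁ w₂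
    refine (avg_mono m₁ fun c₁ => avg_mono m₂ fun c₂ => hpt c₁ c₂ w₁ w₂).trans (le_of_eq ?_)
    simp only [avg_add, avg_sum]
    have e0 : (avg (prodWeight fun _ : Fin M₁ => P₁) fun c₁ =>
        avg (prodWeight fun _ : Fin M₂ => P₂) fun c₂ => T₀ (c₁ w₁) (c₂ w₂)) =
        avg P₁ fun a₁ => avg P₂ fun a₂ => T₀ a₁ a₂ := by
      simp only [fun a => avg_prodWeight_apply h₂ w₂ (T₀ a)]
      exact avg_prodWeight_apply h₁ w₁ fun a => avg P₂ fun a₂ => T₀ a a₂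
    have e1 : ∀ w₁' ∈ Finset.univ.erase w₁, (avg (prodWeight fun _ : Fin M₁ => P₁) fun c₁ =>
        avg (prodWeight fun _ : Fin M₂ => P₂) fun c₂ => T₁ (c₁ w₁) (c₁ w₁') (c₂ w₂)) =
        avg P₁ fun a₁ => avg P₁ fun a₁' => avg P₂ fun a₂ => T₁ a₁ a₁' a₂ := by
      intro w₁' hw
      simp only [fun a a' => avg_prodWeight_apply h₂ w₂ (T₁ a a')]
      exact avg_prodWeight_apply₂ h₁ (Finset.ne_of_mem_erase hw)
        fun a a' => avg P₂ fun a₂ => T₁ a a' a₂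
    have e2 : ∀ w₂' ∈ Finset.univ.erase w₂, (avg (prodWeight fun _ : Fin M₁ => P₁) fun c₁ =>
        avg (prodWeight fun _ : Fin M₂ => P₂) fun c₂ => T₂ (c₁ w₁) (c₂ w₂) (c₂ w₂')) =
        avg P₁ fun a₁ => avg P₂ fun a₂ => avg P₂ fun a₂' => T₂ a₁ a₂ a₂' := by
      intro w₂' hw
      simp only [fun a => avg_prodWeight_apply₂ h₂ (Finset.ne_of_mem_erase hw) (T₂ a)]
      exact avg_prodWeight_apply h₁ w₁
        fun a => avg P₂ fun a₂ => avg P₂ fun a₂' => T₂ a a₂ a₂'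
    have e3 : ∀ w₁' ∈ Finset.univ.erase w₁, ∀ w₂' ∈ Finset.univ.erase w₂,
        (avg (prodWeight fun _ : Fin M₁ => P₁) fun c₁ =>
        avg (prodWeight fun _ : Fin M₂ => P₂) fun c₂ =>
          T₃ (c₁ w₁) (c₁ w₁') (c₂ w₂) (c₂ w₂')) =
        avg P₁ fun a₁ => avg P₁ fun a₁' => avg P₂ fun a₂ => avg P₂ fun a₂' =>
          T₃ a₁ a₁' a₂ a₂' := by
      intro w₁' hw₁ w₂' hw₂
      simp only [fun a a' => avg_prodWeight_apply₂ h₂ (Finset.ne_of_mem_erase hw₂) (T₃ a a')]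
      exact avg_prodWeight_apply₂ h₁ (Finset.ne_of_mem_erase hw₁)
        fun a a' => avg P₂ fun a₂ => avg P₂ fun a₂' => T₃ a a' a₂ a₂'
    rw [e0, Finset.sum_congr rfl e1, Finset.sum_congr rfl e2,
      Finset.sum_congr rfl fun w₁' h => Finset.sum_congr rfl (e3 w₁' h)]
    simp only [Finset.sum_const, nsmul_eq_mul, hcard]
    rw [hD]
    ring
  have hM₁ : (0 : ℝ) < M₁ := Nat.cast_pos.2 (NeZero.pos M₁)
  have hM₂ : (0 : ℝ) < M₂ := Nat.cast_pos.2 (NeZero.pos M₂)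
  have htot : (avg (prodWeight fun _ : Fin M₁ => P₁) fun c₁ =>
      avg (prodWeight fun _ : Fin M₂ => P₂) fun c₂ => ∑ w₁, ∑ w₂, e c₁ c₂ w₁ w₂) ≤
      M₁ * M₂ * D := by
    simp only [avg_sum]
    refine (Finset.sum_le_sum fun w₁ _ => Finset.sum_le_sum fun w₂ _ => hmean w₁ w₂).trans
      (le_of_eq ?_)
    simp [mul_assoc]
  obtain ⟨c₁, hc₁⟩ := exists_le_of_avg_le m₁ htot
  obtain ⟨c₂, hc₂⟩ := exists_le_of_avg_le m₂ hc₁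
  refine ⟨c₁, c₂, d c₁ c₂, ?_⟩
  rw [div_le_iff₀ (by positivity), mul_comm D]
  exact hc₂

open scoped Classical in
/-- Random coding bound with likelihood ratio thresholds. -/
theorem exists_code_of_threshold {M₁ M₂ : ℕ} [NeZero M₁] [NeZero M₂] {P₁ : A₁ → ℝ} {P₂ : A₂ → ℝ}
    (h₁ : P₁ ∈ stdSimplex ℝ A₁) (h₂ : P₂ ∈ stdSimplex ℝ A₂) (W : A₁ → A₂ → B → ℝ)
    (hW : ∀ a₁ a₂, W a₁ a₂ ∈ stdSimplex ℝ B) {t₁ t₂ t₃ : ℝ} (ht₁ : 0 < t₁) (ht₂ : 0 < t₂)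
    (ht₃ : 0 < t₃) :
    ∃ (c₁ : Fin M₁ → A₁) (c₂ : Fin M₂ → A₂) (d : B → Fin M₁ × Fin M₂),
      (∑ w₁, ∑ w₂, ∑ b, if d b = (w₁, w₂) then 0 else W (c₁ w₁) (c₂ w₂) b) / (M₁ * M₂ : ℝ) ≤
        (avg P₁ fun a₁ => avg P₂ fun a₂ => ∑ b,
          if W a₁ a₂ b ≤ t₁ * (avg P₁ fun a₁ => W a₁ a₂ b) then W a₁ a₂ b else 0) +
        (avg P₁ fun a₁ => avg P₂ fun a₂ => ∑ b,
          if W a₁ a₂ b ≤ t₂ * (avg P₂ fun a₂ => W a₁ a₂ b) then W a₁ a₂ b else 0) +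
        (avg P₁ fun a₁ => avg P₂ fun a₂ => ∑ b,
          if W a₁ a₂ b ≤ t₃ * (avg P₁ fun a₁ => avg P₂ fun a₂ => W a₁ a₂ b)
            then W a₁ a₂ b else 0) +
        (M₁ - 1) / t₁ + (M₂ - 1) / t₂ + (M₁ - 1) * (M₂ - 1) / t₃ := by
  set U₁ : A₂ → B → ℝ := fun a₂ b => avg P₁ fun a₁ => W a₁ a₂ b with hU₁
  set U₂ : A₁ → B → ℝ := fun a₁ b => avg P₂ fun a₂ => W a₁ a₂ b with hU₂
  set U₃ : B → ℝ := fun b => avg P₁ fun a₁ => avg P₂ fun a₂ => W a₁ a₂ b with hU₃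
  set G : A₁ → A₂ → B → Prop := fun a₁ a₂ b =>
    t₁ * U₁ a₂ b < W a₁ a₂ b ∧ t₂ * U₂ a₁ b < W a₁ a₂ b ∧ t₃ * U₃ b < W a₁ a₂ b with hG
  clear_value G
  obtain ⟨c₁, c₂, d, h⟩ := exists_code_of_rule (M₁ := M₁) (M₂ := M₂) h₁ h₂ W
    (fun a₁ a₂ => (hW a₁ a₂).1) G
  refine ⟨c₁, c₂, d, h.trans ?_⟩
  have hM : ∀ M : ℕ, ∀ [NeZero M], (0 : ℝ) ≤ M - 1 := fun M _ => by
    have : (1 : ℝ) ≤ M := by exact_mod_cast NeZero.one_le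
    linarith
  have hM₁ := hM M₁
  have hM₂ := hM M₂
  have b0 : (avg P₁ fun a₁ => avg P₂ fun a₂ => ∑ b, if G a₁ a₂ b then 0 else W a₁ a₂ b) ≤
      (avg P₁ fun a₁ => avg P₂ fun a₂ => ∑ b,
          if W a₁ a₂ b ≤ t₁ * U₁ a₂ b then W a₁ a₂ b else 0) +
        (avg P₁ fun a₁ => avg P₂ fun a₂ => ∑ b,
          if W a₁ a₂ b ≤ t₂ * U₂ a₁ b then W a₁ a₂ b else 0) +
        (avg P₁ fun a₁ => avg P₂ fun a₂ => ∑ b,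
          if W a₁ a₂ b ≤ t₃ * U₃ b then W a₁ a₂ b else 0) := by
    rw [← avg_add, ← avg_add]
    refine avg_mono h₁ fun a₁ => ?_
    rw [← avg_add, ← avg_add]
    refine avg_mono h₂ fun a₂ => ?_
    rw [← Finset.sum_add_distrib, ← Finset.sum_add_distrib]
    refine Finset.sum_le_sum fun b _ => ?_
    have hx := (hW a₁ a₂).1 b
    by_cases g1 : W a₁ a₂ b ≤ t₁ * U₁ a₂ b <;> by_cases g2 : W a₁ a₂ b ≤ t₂ * U₂ a₁ b <;>
      by_cases g3 : W a₁ a₂ b ≤ t₃ * U₃ b <;>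
      simp [hG, g1, g2, g3, ← not_le] <;> linarith
  have hle : ∀ {t u x : ℝ} {g : Prop} [Decidable g], 0 < t → 0 ≤ x → (g → t * u < x) →
      (if g then u else 0) ≤ x / t := by
    intro t u x g _ ht hx hg
    split_ifs with h
    · rw [le_div_iff₀ ht, mul_comm]; exact (hg h).le
    · positivity
  -- Change of measure: with the accepted codeword `a₁'` held fixed, averaging over the true `a₁`
  -- replaces `W` by the output weight `U₁`, which acceptance bounds by `W a₁' a₂ b / t₁`. Summing
  -- over `b` leaves `1 / t₁`; the other two cases are alike.
  have b1 : (avg P₁ fun a₁ => avg P₁ fun a₁' => avg P₂ fun a₂ =>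
          ∑ b, if G a₁' a₂ b then W a₁ a₂ b else 0) ≤ 1 / t₁ := by
    rw [avg_comm]
    refine (avg_mono h₁ fun a₁' => ?_).trans_eq (avg_const h₁ _)
    rw [avg_comm]
    refine (avg_mono h₂ fun a₂ => ?_).trans_eq (avg_const h₂ _)
    rw [avg_sum]
    refine (Finset.sum_le_sum (g := fun b => W a₁' a₂ b / t₁) fun b _ => ?_).trans_eq ?_
    · rw [avg_ite]
      exact hle ht₁ ((hW _ _).1 _) fun h => by rw [hG] at h; exact h.1
    · rw [← Finset.sum_div, (hW _ _).2]
  have b2 : (avg P₁ fun a₁ => avg P₂ fun a₂ => avg P₂ fun a₂' =>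
          ∑ b, if G a₁ a₂' b then W a₁ a₂ b else 0) ≤ 1 / t₂ := by
    refine (avg_mono h₁ fun a₁ => ?_).trans_eq (avg_const h₁ _)
    rw [avg_comm]
    refine (avg_mono h₂ fun a₂' => ?_).trans_eq (avg_const h₂ _)
    rw [avg_sum]
    refine (Finset.sum_le_sum (g := fun b => W a₁ a₂' b / t₂) fun b _ => ?_).trans_eq ?_
    · rw [avg_ite]
      exact hle ht₂ ((hW _ _).1 _) fun h => by rw [hG] at h; exact h.2.1
    · rw [← Finset.sum_div, (hW _ _).2]
  have b3 : (avg P₁ fun a₁ => avg P₁ fun a₁' => avg P₂ fun a₂ => avg P₂ fun a₂' =>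
          ∑ b, if G a₁' a₂' b then W a₁ a₂ b else 0) ≤ 1 / t₃ := by
    rw [avg_comm]
    refine (avg_mono h₁ fun a₁' => ?_).trans_eq (avg_const h₁ _)
    have : ∀ a₁, (avg P₂ fun a₂ => avg P₂ fun a₂' =>
        ∑ b, if G a₁' a₂' b then W a₁ a₂ b else 0) = avg P₂ fun a₂' => avg P₂ fun a₂ =>
        ∑ b, if G a₁' a₂' b then W a₁ a₂ b else 0 := fun a₁ => avg_comm _ _ _
    simp only [this]
    rw [avg_comm]
    refine (avg_mono h₂ fun a₂' => ?_).trans_eq (avg_const h₂ _)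
    simp only [avg_sum]
    refine (Finset.sum_le_sum (g := fun b => W a₁' a₂' b / t₃) fun b _ => ?_).trans_eq ?_
    · simp only [avg_ite]
      exact hle ht₃ ((hW _ _).1 _) fun h => by rw [hG] at h; exact h.2.2
    · rw [← Finset.sum_div, (hW _ _).2]
  have f1 := mul_le_mul_of_nonneg_left b1 hM₁
  have f2 := mul_le_mul_of_nonneg_left b2 hM₂
  have f3 := mul_le_mul_of_nonneg_left b3 (mul_nonneg hM₁ hM₂)
  simp only [mul_one_div] at f1 f2 f3
  simp only [hU₁, hU₂, hU₃] at b0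
  linarith

end OneShot


/-! ## A Chernoff bound -/

/-- The moment generating function equals `1` at `0` and has derivative `avg P f < 0` there, so it
drops below `1` just to the right. -/
theorem exists_avg_exp_lt_one {Z : Type*} [Fintype Z] {P f : Z → ℝ} (hP : P ∈ stdSimplex ℝ Z)
    (hf : avg P f < 0) : ∃ s > 0, avg P (fun z => Real.exp (s * f z)) < 1 := by
  have hd : HasDerivAt (fun s : ℝ => avg P fun z => Real.exp (s * f z)) (avg P f) 0 := by
    unfold avg
    refine HasDerivAt.fun_sum fun z _ => ?_
    have h := (((hasDerivAt_id (0 : ℝ)).mul_const (f z)).exp).const_mul (P z)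
    simpa using h
  have h0 : (avg P fun z => Real.exp (0 * f z)) = 1 := by
    simp only [zero_mul, Real.exp_zero]
    exact avg_const hP 1
  have hs := (hasDerivAt_iff_tendsto_slope.1 hd).eventually (gt_mem_nhds hf)
  have hs' : ∀ᶠ s in nhdsWithin (0 : ℝ) (Set.Ioi 0),
      slope (fun s : ℝ => avg P fun z => Real.exp (s * f z)) 0 s < 0 :=
    hs.filter_mono (nhdsWithin_mono _ fun x hx => ne_of_gt hx)
  obtain ⟨s, hs1, hs2⟩ := (hs'.and self_mem_nhdsWithin).exists
  have hs2 : (0 : ℝ) < s := hs2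
  refine ⟨s, hs2, ?_⟩
  rw [slope_def_field, h0, sub_zero, div_lt_iff₀ hs2, zero_mul] at hs1
  linarith

/-- On the event in question the sum of the exponents is nonnegative, so the inserted exponential
factor is at least `1`. If the product of the `w i` is nonzero, the event forces every `u i` to be
positive, and the logarithms split. -/
theorem ite_prod_le_prod_exp {ι : Type*} [Fintype ι] {w u : ι → ℝ} (hw : ∀ i, 0 ≤ w i)
    (hu : ∀ i, 0 ≤ u i) {s J : ℝ} (hs : 0 ≤ s) :
    (if ∏ i, w i ≤ Real.exp (Fintype.card ι * J) * ∏ i, u i then ∏ i, w i else 0) ≤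
      ∏ i, (w i * Real.exp (s * (J - Real.log (w i / u i)))) := by
  have h0 : 0 ≤ ∏ i, (w i * Real.exp (s * (J - Real.log (w i / u i)))) :=
    Finset.prod_nonneg fun i _ => mul_nonneg (hw i) (Real.exp_nonneg _)
  split_ifs with h
  swap
  · exact h0
  by_cases hz : ∏ i, w i = 0
  · rw [hz]; exact h0
  have hw0 : ∀ i, 0 < w i := fun i =>
    lt_of_le_of_ne (hw i) fun h => hz (Finset.prod_eq_zero (Finset.mem_univ i) h.symm)
  have hwp : 0 < ∏ i, w i := Finset.prod_pos fun i _ => hw0 i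
  have hup : ∏ i, u i ≠ 0 := fun h' => by
    rw [h', mul_zero] at h; linarith
  have hu0 : ∀ i, 0 < u i := fun i =>
    lt_of_le_of_ne (hu i) fun h => hup (Finset.prod_eq_zero (Finset.mem_univ i) h.symm)
  rw [Finset.prod_mul_distrib, ← Real.exp_sum]
  refine le_mul_of_one_le_right hwp.le (Real.one_le_exp ?_)
  rw [← Finset.mul_sum]
  refine mul_nonneg hs ?_
  rw [Finset.sum_sub_distrib]
  simp only [fun i => Real.log_div (hw0 i).ne' (hu0 i).ne', Finset.sum_sub_distrib]
  rw [← Real.log_prod fun i _ => (hw0 i).ne', ← Real.log_prod fun i _ => (hu0 i).ne']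
  have := Real.log_le_log hwp h
  rw [Real.log_mul (Real.exp_ne_zero _) hup, Real.log_exp] at this
  simp only [Finset.sum_const, Finset.card_univ, nsmul_eq_mul]
  linarith

/-! ## Information as an average of information densities -/

/-- The mass function of a law on a finite set, with real values. -/
def weight {A : Type*} (P : PMF A) (a : A) : ℝ := (P a).toReal

theorem weight_nonneg {A : Type*} (P : PMF A) (a : A) : 0 ≤ weight P a := ENNReal.toReal_nonneg

theorem weight_mem {A : Type*} [Fintype A] (P : PMF A) : weight P ∈ stdSimplex ℝ A := by
  refine ⟨weight_nonneg P, ?_⟩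
  simp only [weight]
  have h := P.tsum_coe
  rw [tsum_fintype] at h
  rw [← ENNReal.toReal_sum fun a _ => P.apply_ne_top a, h, ENNReal.toReal_one]

section Info

variable {Q X₁ X₂ Y : Type*} [Fintype Q] [Fintype X₁] [Fintype X₂] [Fintype Y]
  (p : InputDist Q X₁ X₂) (W : X₁ → X₂ → PMF Y)

/-- The average of a function under `p(q) p(x₁|q) p(x₂|q) p(y|x₁,x₂)`. -/
def InputDist.expect (f : Q → X₁ → X₂ → Y → ℝ) : ℝ :=
  avg (weight p.pQ) fun q => avg (weight (p.p₁ q)) fun x₁ => avg (weight (p.p₂ q)) fun x₂ =>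
    ∑ y, weight (W x₁ x₂) y * f q x₁ x₂ y

/-- `p(y|x₂,q)`. -/
def InputDist.out₁ (q : Q) (x₂ : X₂) (y : Y) : ℝ :=
  avg (weight (p.p₁ q)) fun x₁ => weight (W x₁ x₂) y

/-- `p(y|x₁,q)`. -/
def InputDist.out₂ (q : Q) (x₁ : X₁) (y : Y) : ℝ :=
  avg (weight (p.p₂ q)) fun x₂ => weight (W x₁ x₂) y

/-- `p(y|q)`. -/
def InputDist.out₁₂ (q : Q) (y : Y) : ℝ :=
  avg (weight (p.p₁ q)) fun x₁ => avg (weight (p.p₂ q)) fun x₂ => weight (W x₁ x₂) y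

theorem avg_nonneg {A : Type*} [Fintype A] (P : PMF A) {f : A → ℝ} (hf : ∀ a, 0 ≤ f a) :
    0 ≤ avg (weight P) f :=
  Finset.sum_nonneg fun a _ => mul_nonneg (weight_nonneg P a) (hf a)

theorem le_avg_of_nonneg {A : Type*} [Fintype A] (P : PMF A) {f : A → ℝ} (hf : ∀ a, 0 ≤ f a)
    (a : A) : weight P a * f a ≤ avg (weight P) f :=
  Finset.single_le_sum (f := fun a => weight P a * f a)
    (fun a _ => mul_nonneg (weight_nonneg P a) (hf a)) (Finset.mem_univ a)

theorem InputDist.out₁_nonneg (q : Q) (x₂ : X₂) (y : Y) : 0 ≤ p.out₁ W q x₂ y :=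
  avg_nonneg _ fun _ => weight_nonneg _ _

theorem InputDist.out₂_nonneg (q : Q) (x₁ : X₁) (y : Y) : 0 ≤ p.out₂ W q x₁ y :=
  avg_nonneg _ fun _ => weight_nonneg _ _

theorem InputDist.out₁₂_nonneg (q : Q) (y : Y) : 0 ≤ p.out₁₂ W q y :=
  avg_nonneg _ fun _ => avg_nonneg _ fun _ => weight_nonneg _ _

theorem InputDist.expect_eq_sum (f : Q → X₁ → X₂ → Y → ℝ) :
    p.expect W f = ∑ q, ∑ x₁, ∑ x₂, ∑ y, p.joint W q x₁ x₂ y * f q x₁ x₂ y := by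
  simp only [InputDist.expect, avg, InputDist.joint, Finset.mul_sum, weight, mul_assoc]

theorem InputDist.expect_add (f g : Q → X₁ → X₂ → Y → ℝ) :
    p.expect W (fun q x₁ x₂ y => f q x₁ x₂ y + g q x₁ x₂ y) = p.expect W f + p.expect W g := by
  simp only [InputDist.expect_eq_sum, mul_add, Finset.sum_add_distrib]

theorem InputDist.expect_const (c : ℝ) : p.expect W (fun _ _ _ _ => c) = c := by
  simp only [InputDist.expect, ← Finset.sum_mul, (weight_mem _).2, one_mul,
    avg_const (weight_mem _)]

/-- Given `q` the inputs are independent, so the quotient in the definition reduces to `p(y|x₁,x₂) /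
p(y|x₂,q)` after cancelling the input probabilities. Where these vanish, both summands are zero. -/
theorem InputDist.info₁_eq_expect : p.info₁ W =
    p.expect W fun q x₁ x₂ y => Real.log (weight (W x₁ x₂) y / p.out₁ W q x₂ y) := by
  rw [InputDist.expect_eq_sum, InputDist.info₁, condMutualInfo]
  simp only [Fintype.sum_prod_type]
  have hs : ∀ f : Q → X₁ → X₂ → Y → ℝ, ∑ x₁, ∑ y, ∑ x₂, ∑ q, f q x₁ x₂ y =
      ∑ q, ∑ x₁, ∑ x₂, ∑ y, f q x₁ x₂ y := by
    intro f
    rw [Finset.sum_comm (s := (Finset.univ : Finset Q))]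
    refine Finset.sum_congr rfl fun x₁ _ => ?_
    rw [Finset.sum_comm]
    rw [Finset.sum_comm (s := (Finset.univ : Finset Q))]
    refine Finset.sum_congr rfl fun x₂ _ => ?_
    exact Finset.sum_comm
  rw [← hs]
  refine Finset.sum_congr rfl fun x₁ _ => Finset.sum_congr rfl fun y _ =>
    Finset.sum_congr rfl fun x₂ _ => Finset.sum_congr rfl fun q _ => ?_
  have e1 : ∀ x, ∑ y', p.joint W q x x₂ y' =
      weight p.pQ q * weight (p.p₁ q) x * weight (p.p₂ q) x₂ := fun x => by
    have := (weight_mem (W x x₂)).2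
    simp only [weight] at this
    simp only [InputDist.joint, ← Finset.mul_sum, weight, this, mul_one]
  have e2 : ∑ x, weight p.pQ q * weight (p.p₁ q) x * weight (p.p₂ q) x₂ =
      weight p.pQ q * weight (p.p₂ q) x₂ := by
    rw [← Finset.sum_mul, ← Finset.mul_sum, (weight_mem (p.p₁ q)).2, mul_one]
  have e3 : ∑ x, p.joint W q x x₂ y =
      weight p.pQ q * weight (p.p₂ q) x₂ * p.out₁ W q x₂ y := by
    simp only [InputDist.out₁, avg, Finset.mul_sum, InputDist.joint, weight]
    exact Finset.sum_congr rfl fun _ _ => by ring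
  simp only [e1, e2, e3]
  have e4 : p.joint W q x₁ x₂ y =
    weight p.pQ q * weight (p.p₁ q) x₁ * weight (p.p₂ q) x₂ * weight (W x₁ x₂) y := rfl
  by_cases h0 : weight p.pQ q * weight (p.p₁ q) x₁ * weight (p.p₂ q) x₂ = 0
  · rw [e4, h0]; simp
  congr 2
  rw [e4]
  have h1 : weight p.pQ q * weight (p.p₂ q) x₂ ≠ 0 := fun h => h0 (by
    rw [mul_right_comm, h, zero_mul])
  rw [mul_right_comm _ _ (weight p.pQ q * weight (p.p₂ q) x₂), ← mul_assoc _ _ (p.out₁ W q x₂ y),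
    mul_div_mul_left _ _ (mul_ne_zero h0 h1)]

theorem InputDist.info₁₂_eq_expect : p.info₁₂ W =
    p.expect W fun q x₁ x₂ y => Real.log (weight (W x₁ x₂) y / p.out₁₂ W q y) := by
  rw [InputDist.expect_eq_sum, InputDist.info₁₂, condMutualInfo]
  simp only [Fintype.sum_prod_type]
  have hs : ∀ f : Q → X₁ → X₂ → Y → ℝ, ∑ x₁, ∑ x₂, ∑ y, ∑ q, f q x₁ x₂ y =
      ∑ q, ∑ x₁, ∑ x₂, ∑ y, f q x₁ x₂ y := by
    intro f
    rw [Finset.sum_comm (s := (Finset.univ : Finset Q))]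
    refine Finset.sum_congr rfl fun x₁ _ => ?_
    rw [Finset.sum_comm (s := (Finset.univ : Finset Q))]
    refine Finset.sum_congr rfl fun x₂ _ => ?_
    exact Finset.sum_comm
  rw [← hs]
  refine Finset.sum_congr rfl fun x₁ _ => Finset.sum_congr rfl fun x₂ _ =>
    Finset.sum_congr rfl fun y _ => Finset.sum_congr rfl fun q _ => ?_
  have e1 : ∀ x x', ∑ y', p.joint W q x x' y' =
      weight p.pQ q * weight (p.p₁ q) x * weight (p.p₂ q) x' := fun x x' => by
    have := (weight_mem (W x x')).2
    simp only [weight] at this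
    simp only [InputDist.joint, ← Finset.mul_sum, weight, this, mul_one]
  have e2 : ∑ x, ∑ x', weight p.pQ q * weight (p.p₁ q) x * weight (p.p₂ q) x' =
      weight p.pQ q := by
    simp only [← Finset.mul_sum, (weight_mem _).2, mul_one]
  have e3 : ∑ x, ∑ x', p.joint W q x x' y = weight p.pQ q * p.out₁₂ W q y := by
    simp only [InputDist.out₁₂, avg, Finset.mul_sum, InputDist.joint, weight]
    exact Finset.sum_congr rfl fun _ _ => Finset.sum_congr rfl fun _ _ => by ring
  simp only [e1, e2, e3]
  have e4 : p.joint W q x₁ x₂ y =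
    weight p.pQ q * weight (p.p₁ q) x₁ * weight (p.p₂ q) x₂ * weight (W x₁ x₂) y := rfl
  by_cases h0 : weight p.pQ q * weight (p.p₁ q) x₁ * weight (p.p₂ q) x₂ = 0
  · rw [e4, h0]; simp
  congr 2
  rw [e4]
  have h1 : weight p.pQ q ≠ 0 := fun h => h0 (by rw [h, zero_mul, zero_mul])
  rw [mul_right_comm _ _ (weight p.pQ q), ← mul_assoc _ _ (p.out₁₂ W q y), mul_div_mul_left _ _ (mul_ne_zero h0 h1)]

/-! ## Exchanging the users -/

/-- The input distribution with the two users exchanged. -/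
def InputDist.swap {Q X₁ X₂ : Type*} (p : InputDist Q X₁ X₂) : InputDist Q X₂ X₁ where
  pQ := p.pQ
  p₁ := p.p₂
  p₂ := p.p₁

/-- The channel with the two users exchanged. -/
def swapChannel {X₁ X₂ Y : Type*} (W : X₁ → X₂ → PMF Y) : X₂ → X₁ → PMF Y :=
  fun x₂ x₁ => W x₁ x₂

theorem InputDist.joint_swap (q : Q) (x₁ : X₁) (x₂ : X₂) (y : Y) :
    p.swap.joint (swapChannel W) q x₂ x₁ y = p.joint W q x₁ x₂ y := by
  simp only [InputDist.joint, InputDist.swap, swapChannel]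
  ring

theorem InputDist.info₁_swap : p.swap.info₁ (swapChannel W) = p.info₂ W := by
  simp only [InputDist.info₁, InputDist.info₂, InputDist.joint_swap]

theorem InputDist.info₂_swap : p.swap.info₂ (swapChannel W) = p.info₁ W := by
  simp only [InputDist.info₁, InputDist.info₂, InputDist.joint_swap]

theorem InputDist.out₁₂_swap (q : Q) (y : Y) :
    p.swap.out₁₂ (swapChannel W) q y = p.out₁₂ W q y :=
  avg_comm _ _ _

theorem InputDist.expect_swap (f : Q → X₁ → X₂ → Y → ℝ) :
    p.swap.expect (swapChannel W) (fun q x₂ x₁ y => f q x₁ x₂ y) = p.expect W f := by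
  simp only [InputDist.expect]
  congr 1
  funext q
  exact avg_comm _ _ _

theorem InputDist.info₁₂_swap : p.swap.info₁₂ (swapChannel W) = p.info₁₂ W := by
  have h := p.expect_swap W fun q x₁ x₂ y => Real.log (weight (W x₁ x₂) y / p.out₁₂ W q y)
  rw [InputDist.info₁₂_eq_expect, InputDist.info₁₂_eq_expect, ← h]
  simp only [InputDist.out₁₂_swap]
  rfl

theorem InputDist.info₂_eq_expect : p.info₂ W =
    p.expect W fun q x₁ x₂ y => Real.log (weight (W x₁ x₂) y / p.out₂ W q x₁ y) := by
  have h := p.expect_swap W fun q x₁ x₂ y => Real.log (weight (W x₁ x₂) y / p.out₂ W q x₁ y)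
  rw [← InputDist.info₁_swap, InputDist.info₁_eq_expect, ← h]
  rfl

/-! ## Inequalities between the information quantities -/

theorem InputDist.out₁_sum (q : Q) (x₂ : X₂) : ∑ y, p.out₁ W q x₂ y = 1 := by
  simp only [InputDist.out₁]
  rw [← avg_sum]
  simp only [(weight_mem _).2, avg_const (weight_mem _)]

theorem InputDist.out₁₂_sum (q : Q) : ∑ y, p.out₁₂ W q y = 1 := by
  simp only [InputDist.out₁₂]
  rw [← avg_sum]
  simp only [← avg_sum, (weight_mem _).2, avg_const (weight_mem _)]

/-- This is `log t ≥ 1 - 1/t`. The last hypothesis excludes `u = 0 < w`, where the convention for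
division by zero would make the right side vanish. -/
theorem mul_log_div_ge {w u : ℝ} (hw : 0 ≤ w) (hu : 0 ≤ u) (h : 0 < w → 0 < u) :
    w - u ≤ w * Real.log (w / u) := by
  rcases hw.eq_or_lt with rfl | hw
  · simpa using hu
  have hu' := h hw
  have := Real.one_sub_inv_le_log_of_pos (div_pos hw hu')
  calc w - u = w * (1 - (w / u)⁻¹) := by field_simp
    _ ≤ _ := mul_le_mul_of_nonneg_left this hw.le

/-- Gibbs' inequality for fixed `q` and `x₂`: bounding each term by a difference of two weights
leaves a difference of total masses, which is zero. -/
theorem InputDist.info₁_nonneg : 0 ≤ p.info₁ W := by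
  rw [InputDist.info₁_eq_expect, InputDist.expect]
  refine avg_nonneg _ fun q => ?_
  rw [avg_comm]
  refine avg_nonneg _ fun x₂ => ?_
  rw [avg_sum]
  have h : ∀ y, (avg (weight (p.p₁ q)) fun x₁ => weight (W x₁ x₂) y - p.out₁ W q x₂ y) ≤
      avg (weight (p.p₁ q)) fun x₁ => weight (W x₁ x₂) y *
        Real.log (weight (W x₁ x₂) y / p.out₁ W q x₂ y) := by
    intro y
    refine Finset.sum_le_sum fun x₁ _ => ?_
    rcases (weight_nonneg (p.p₁ q) x₁).eq_or_lt with h0 | h0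
    · rw [← h0, zero_mul, zero_mul]
    refine mul_le_mul_of_nonneg_left (mul_log_div_ge (weight_nonneg _ _)
      (p.out₁_nonneg W _ _ _) fun hw => ?_) h0.le
    exact (mul_pos h0 hw).trans_le
      (le_avg_of_nonneg (p.p₁ q) (fun x => weight_nonneg (W x x₂) y) x₁)
  refine le_trans (le_of_eq ?_) (Finset.sum_le_sum fun y _ => h y)
  simp only [sub_eq_add_neg, avg_add, avg_const (weight_mem _)]
  rw [Finset.sum_add_distrib, Finset.sum_neg_distrib, p.out₁_sum]
  have := p.out₁_sum W q x₂
  simp only [InputDist.out₁] at this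
  rw [this]; ring

theorem InputDist.info₂_nonneg : 0 ≤ p.info₂ W := by
  rw [← InputDist.info₁_swap]
  exact InputDist.info₁_nonneg _ _

/-- The difference is `I(X₂;Y|Q)`, the average of `log (out₁ / out₁₂)`, which is at least the
average of `1 - out₁₂ / out₁`; the latter is nonnegative since both output weights sum to `1`. -/
theorem InputDist.info₁_le_info₁₂ : p.info₁ W ≤ p.info₁₂ W := by
  rw [InputDist.info₁_eq_expect, InputDist.info₁₂_eq_expect, InputDist.expect, InputDist.expect]
  refine avg_mono (weight_mem _) fun q => ?_
  have h : ∀ x₁ x₂ y, weight (p.p₁ q) x₁ * (weight (p.p₂ q) x₂ * (weight (W x₁ x₂) y *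
      Real.log (weight (W x₁ x₂) y / p.out₁ W q x₂ y) +
      weight (W x₁ x₂) y * (1 - p.out₁₂ W q y / p.out₁ W q x₂ y))) ≤
      weight (p.p₁ q) x₁ * (weight (p.p₂ q) x₂ * (weight (W x₁ x₂) y *
      Real.log (weight (W x₁ x₂) y / p.out₁₂ W q y))) := by
    intro x₁ x₂ y
    rcases (weight_nonneg (p.p₁ q) x₁).eq_or_lt with h1 | h1
    · rw [← h1, zero_mul, zero_mul]
    rcases (weight_nonneg (p.p₂ q) x₂).eq_or_lt with h2 | h2
    · rw [← h2, zero_mul, zero_mul]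
    rcases (weight_nonneg (W x₁ x₂) y).eq_or_lt with h3 | h3
    · simp [← h3]
    refine mul_le_mul_of_nonneg_left (mul_le_mul_of_nonneg_left ?_ h2.le) h1.le
    rw [← mul_add]
    refine mul_le_mul_of_nonneg_left ?_ h3.le
    have g1 : 0 < p.out₁ W q x₂ y := (mul_pos h1 h3).trans_le
      (le_avg_of_nonneg (p.p₁ q) (fun x => weight_nonneg (W x x₂) y) x₁)
    have g2 : 0 < p.out₁₂ W q y := (mul_pos h1 ((mul_pos h2 h3).trans_le
      (le_avg_of_nonneg (p.p₂ q) (fun x => weight_nonneg (W x₁ x) y) x₂))).trans_le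
      (le_avg_of_nonneg (p.p₁ q) (fun x => avg_nonneg _ fun x' => weight_nonneg (W x x') y) x₁)
    have := Real.one_sub_inv_le_log_of_pos (div_pos g1 g2)
    rw [inv_div, Real.log_div g1.ne' g2.ne'] at this
    rw [Real.log_div h3.ne' g1.ne', Real.log_div h3.ne' g2.ne']
    linarith
  have h' : (avg (weight (p.p₁ q)) fun x₁ => avg (weight (p.p₂ q)) fun x₂ =>
      ∑ y, (weight (W x₁ x₂) y * Real.log (weight (W x₁ x₂) y / p.out₁ W q x₂ y) +
      weight (W x₁ x₂) y * (1 - p.out₁₂ W q y / p.out₁ W q x₂ y))) ≤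
      avg (weight (p.p₁ q)) fun x₁ => avg (weight (p.p₂ q)) fun x₂ =>
      ∑ y, weight (W x₁ x₂) y * Real.log (weight (W x₁ x₂) y / p.out₁₂ W q y) := by
    simp only [avg, Finset.mul_sum]
    exact Finset.sum_le_sum fun x₁ _ => Finset.sum_le_sum fun x₂ _ =>
      Finset.sum_le_sum fun y _ => h x₁ x₂ y
  simp only [Finset.sum_add_distrib, avg_add] at h'
  have h'' : 0 ≤ avg (weight (p.p₁ q)) fun x₁ => avg (weight (p.p₂ q)) fun x₂ =>
      ∑ y, weight (W x₁ x₂) y * (1 - p.out₁₂ W q y / p.out₁ W q x₂ y) := by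
    rw [avg_comm]
    refine avg_nonneg _ fun x₂ => ?_
    rw [avg_sum]
    have hy : ∀ y, p.out₁ W q x₂ y - p.out₁₂ W q y ≤ avg (weight (p.p₁ q)) fun x₁ =>
        weight (W x₁ x₂) y * (1 - p.out₁₂ W q y / p.out₁ W q x₂ y) := by
      intro y
      have : (avg (weight (p.p₁ q)) fun x₁ =>
          weight (W x₁ x₂) y * (1 - p.out₁₂ W q y / p.out₁ W q x₂ y)) =
          p.out₁ W q x₂ y * (1 - p.out₁₂ W q y / p.out₁ W q x₂ y) := by
        rw [InputDist.out₁, avg, avg, Finset.sum_mul]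
        exact Finset.sum_congr rfl fun _ _ => by rw [mul_assoc]
      rw [this]
      -- Equality holds where `out₁` is positive; where it vanishes only the inequality survives,
      -- and it suffices.
      rcases (p.out₁_nonneg W q x₂ y).eq_or_lt with h0 | h0
      · rw [← h0]; simpa using p.out₁₂_nonneg W q y
      · apply le_of_eq; field_simp
    refine le_trans (le_of_eq ?_) (Finset.sum_le_sum fun y _ => hy y)
    rw [Finset.sum_sub_distrib, p.out₁_sum, p.out₁₂_sum, sub_self]
  linarith

/-! ## Block codes by random coding -/

/-- The Chernoff bound for the information density, stated for a general denominator `U` so that it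
covers all three mutual informations. The time-sharing sequence is drawn letter by letter as well,
so the bounded average factors into `n` equal factors `ρ < 1`. -/
theorem InputDist.exists_tail_bound {U : Q → X₁ → X₂ → Y → ℝ} (hU : ∀ q x₁ x₂ y, 0 ≤ U q x₁ x₂ y)
    {J : ℝ} (hJ : J < p.expect W fun q x₁ x₂ y => Real.log (weight (W x₁ x₂) y / U q x₁ x₂ y)) :
    ∃ ρ : ℝ, 0 ≤ ρ ∧ ρ < 1 ∧ ∀ n : ℕ, (avg (prodWeight fun _ : Fin n => weight p.pQ) fun q =>
      avg (prodWeight fun i => weight (p.p₁ (q i))) fun a₁ =>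
      avg (prodWeight fun i => weight (p.p₂ (q i))) fun a₂ => ∑ b : Fin n → Y,
      if ∏ i, weight (W (a₁ i) (a₂ i)) (b i) ≤
        Real.exp (n * J) * ∏ i, U (q i) (a₁ i) (a₂ i) (b i)
      then ∏ i, weight (W (a₁ i) (a₂ i)) (b i) else 0) ≤ ρ ^ n := by
  set P : Q × X₁ × X₂ × Y → ℝ := fun z => p.joint W z.1 z.2.1 z.2.2.1 z.2.2.2 with hPdef
  set f : Q × X₁ × X₂ × Y → ℝ := fun z =>
    J - Real.log (weight (W z.2.1 z.2.2.1) z.2.2.2 / U z.1 z.2.1 z.2.2.1 z.2.2.2) with hf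
  have hexp : ∀ g : Q → X₁ → X₂ → Y → ℝ,
      p.expect W g = avg P fun z => g z.1 z.2.1 z.2.2.1 z.2.2.2 := by
    intro g
    rw [InputDist.expect_eq_sum]
    simp only [avg, Fintype.sum_prod_type, hPdef]
  have hP : P ∈ stdSimplex ℝ _ := by
    refine ⟨fun z => ?_, ?_⟩
    · simp only [hPdef, InputDist.joint]; positivity
    · have h1 := p.expect_const W 1
      rw [hexp] at h1
      simpa [avg] using h1
  have hneg : avg P f < 0 := by
    have h1 := hexp fun q x₁ x₂ y => J - Real.log (weight (W x₁ x₂) y / U q x₁ x₂ y)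
    rw [← h1]
    have h2 := p.expect_add W (fun q x₁ x₂ y => J - Real.log (weight (W x₁ x₂) y / U q x₁ x₂ y))
      (fun q x₁ x₂ y => Real.log (weight (W x₁ x₂) y / U q x₁ x₂ y))
    simp only [sub_add_cancel, InputDist.expect_const] at h2
    linarith
  obtain ⟨s, hs, hs1⟩ := exists_avg_exp_lt_one hP hneg
  have h1 := hexp fun q x₁ x₂ y =>
    Real.exp (s * (J - Real.log (weight (W x₁ x₂) y / U q x₁ x₂ y)))
  rw [← h1] at hs1
  refine ⟨_, ?_, hs1, fun n => ?_⟩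
  · exact avg_nonneg _ fun _ => avg_nonneg _ fun _ => avg_nonneg _ fun _ =>
      Finset.sum_nonneg fun _ _ => mul_nonneg (weight_nonneg _ _) (Real.exp_nonneg _)
  set g : Q → X₁ → X₂ → Y → ℝ := fun q x₁ x₂ y => weight (W x₁ x₂) y *
    Real.exp (s * (J - Real.log (weight (W x₁ x₂) y / U q x₁ x₂ y))) with hg
  calc _ ≤ avg (prodWeight fun _ : Fin n => weight p.pQ) fun q =>
      avg (prodWeight fun i => weight (p.p₁ (q i))) fun a₁ =>
      avg (prodWeight fun i => weight (p.p₂ (q i))) fun a₂ => ∑ b : Fin n → Y,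
        ∏ i, g (q i) (a₁ i) (a₂ i) (b i) := by
        refine avg_mono (prodWeight_mem fun _ => weight_mem _) fun q =>
          avg_mono (prodWeight_mem fun _ => weight_mem _) fun a₁ =>
          avg_mono (prodWeight_mem fun _ => weight_mem _) fun a₂ => Finset.sum_le_sum fun b _ => ?_
        have := ite_prod_le_prod_exp (w := fun i => weight (W (a₁ i) (a₂ i)) (b i))
          (u := fun i => U (q i) (a₁ i) (a₂ i) (b i)) (fun _ => weight_nonneg _ _)
          (fun _ => hU _ _ _ _) (J := J) hs.le
        rw [Fintype.card_fin] at this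
        exact this
    _ = (avg (weight p.pQ) fun q => avg (weight (p.p₁ q)) fun x₁ => avg (weight (p.p₂ q)) fun x₂ =>
        ∑ y, g q x₁ x₂ y) ^ n := by
        simp only [fun (q : Fin n → Q) (a₁ : Fin n → X₁) (a₂ : Fin n → X₂) =>
          sum_prod_pi fun i y => g (q i) (a₁ i) (a₂ i) y]
        simp only [fun (q : Fin n → Q) (a₁ : Fin n → X₁) =>
          avg_prodWeight_prod (fun i => weight (p.p₂ (q i))) fun i x => ∑ y, g (q i) (a₁ i) x y]
        simp only [fun (q : Fin n → Q) =>
          avg_prodWeight_prod (fun i => weight (p.p₁ (q i))) fun i x =>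
            avg (weight (p.p₂ (q i))) fun x₂ => ∑ y, g (q i) x x₂ y]
        rw [avg_prodWeight_prod (fun _ : Fin n => weight p.pQ) fun _ q =>
          avg (weight (p.p₁ q)) fun x₁ => avg (weight (p.p₂ q)) fun x₂ => ∑ y, g q x₁ x₂ y]
        rw [Finset.prod_const, Finset.card_univ, Fintype.card_fin]
    _ = _ := rfl

open scoped Classical in
/-- The average error probability of a block code. -/
def BlockCode.errorProb {X₁ X₂ Y : Type*} [Fintype Y] {M₁ M₂ n : ℕ}
    (B : BlockCode X₁ X₂ Y M₁ M₂ n) (W : X₁ → X₂ → PMF Y) : ℝ :=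
  (∑ w₁, ∑ w₂, ∑ v : Fin n → Y, if B.dec₁ v = w₁ ∧ B.dec₂ v = w₂ then 0 else
    ∏ i, weight (W (B.enc₁ w₁ i) (B.enc₂ w₂ i)) (v i)) / (M₁ * M₂ : ℝ)

/-- The direct coding theorem for the multiple-access channel. -/
theorem InputDist.exists_blockCode {δ ε : ℝ} (hδ : 0 < δ) (hε : 0 < ε) :
    ∃ n₁ : ℕ, ∀ n ≥ n₁, ∀ M₁ M₂ : ℕ, 0 < M₁ → 0 < M₂ →
      (M₁ : ℝ) - 1 ≤ Real.exp (n * (p.info₁ W - δ)) →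
      (M₂ : ℝ) - 1 ≤ Real.exp (n * (p.info₂ W - δ)) →
      ((M₁ : ℝ) - 1) * ((M₂ : ℝ) - 1) ≤ Real.exp (n * (p.info₁₂ W - δ)) →
      ∃ B : BlockCode X₁ X₂ Y M₁ M₂ n, B.errorProb W < ε := by
  classical
  -- Thresholds are placed at exponent `I - δ/2`: below the mean density, so that the tail bounds
  -- apply, and `δ/2` above the exponent `I - δ` of the message sizes, so that wrong pairs
  -- contribute at most `κ ^ n` each way.
  have hlt : ∀ x : ℝ, x - δ / 2 < x := fun x => by linarith
  obtain ⟨ρ₁, h₁0, h₁1, hρ₁⟩ := p.exists_tail_bound W (U := fun q _ x₂ y => p.out₁ W q x₂ y)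
    (fun q _ x₂ y => p.out₁_nonneg W q x₂ y) ((hlt (p.info₁ W)).trans_eq (p.info₁_eq_expect W))
  obtain ⟨ρ₂, h₂0, h₂1, hρ₂⟩ := p.exists_tail_bound W (U := fun q x₁ _ y => p.out₂ W q x₁ y)
    (fun q x₁ _ y => p.out₂_nonneg W q x₁ y) ((hlt (p.info₂ W)).trans_eq (p.info₂_eq_expect W))
  obtain ⟨ρ₃, h₃0, h₃1, hρ₃⟩ := p.exists_tail_bound W (U := fun q _ _ y => p.out₁₂ W q y)
    (fun q _ _ y => p.out₁₂_nonneg W q y) ((hlt (p.info₁₂ W)).trans_eq (p.info₁₂_eq_expect W))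
  set κ : ℝ := Real.exp (-(δ / 2)) with hκ
  have hκ0 : 0 ≤ κ := (Real.exp_pos _).le
  have hκ1 : κ < 1 := by rw [hκ, Real.exp_lt_one_iff]; linarith
  have hlim : Tendsto (fun n : ℕ => ρ₁ ^ n + ρ₂ ^ n + ρ₃ ^ n + κ ^ n + κ ^ n + κ ^ n) atTop
      (𝓝 (0 + 0 + 0 + 0 + 0 + 0)) :=
    (((((tendsto_pow_atTop_nhds_zero_of_lt_one h₁0 h₁1).add
      (tendsto_pow_atTop_nhds_zero_of_lt_one h₂0 h₂1)).add
      (tendsto_pow_atTop_nhds_zero_of_lt_one h₃0 h₃1)).add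
      (tendsto_pow_atTop_nhds_zero_of_lt_one hκ0 hκ1)).add
      (tendsto_pow_atTop_nhds_zero_of_lt_one hκ0 hκ1)).add
      (tendsto_pow_atTop_nhds_zero_of_lt_one hκ0 hκ1)
  simp only [add_zero] at hlim
  obtain ⟨n₁, hn₁⟩ := eventually_atTop.1 (hlim.eventually (gt_mem_nhds hε))
  refine ⟨n₁, fun n hn M₁ M₂ hM₁ hM₂ hc₁ hc₂ hc₃ => ?_⟩
  have : NeZero M₁ := ⟨hM₁.ne'⟩
  have : NeZero M₂ := ⟨hM₂.ne'⟩
  have hdiv : ∀ {M i : ℝ}, M ≤ Real.exp (n * (i - δ)) → M / Real.exp (n * (i - δ / 2)) ≤ κ ^ n := by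
    intro M i hM
    rw [div_le_iff₀ (Real.exp_pos _), hκ, ← Real.exp_nat_mul, ← Real.exp_add]
    refine hM.trans_eq (congrArg _ (by ring))
  -- The three tails are added before choosing `q`, so that one time-sharing sequence serves all of
  -- them.
  have hqs := add_le_add (add_le_add (hρ₁ n) (hρ₂ n)) (hρ₃ n)
  rw [← avg_add, ← avg_add] at hqs
  obtain ⟨q, hq⟩ := exists_le_of_avg_le (prodWeight_mem fun _ => weight_mem _) hqs
  set P₁ : (Fin n → X₁) → ℝ := prodWeight fun i => weight (p.p₁ (q i)) with hP₁
  set P₂ : (Fin n → X₂) → ℝ := prodWeight fun i => weight (p.p₂ (q i)) with hP₂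
  have hW : ∀ (a₁ : Fin n → X₁) (a₂ : Fin n → X₂),
      (fun b : Fin n → Y => ∏ i, weight (W (a₁ i) (a₂ i)) (b i)) ∈ stdSimplex ℝ (Fin n → Y) :=
    fun a₁ a₂ => prodWeight_mem (P := fun i => weight (W (a₁ i) (a₂ i))) fun _ => weight_mem _
  obtain ⟨c₁, c₂, d, hcode⟩ := exists_code_of_threshold (M₁ := M₁) (M₂ := M₂)
    (P₁ := P₁) (P₂ := P₂) (prodWeight_mem fun _ => weight_mem _)
    (prodWeight_mem fun _ => weight_mem _)
    (fun a₁ a₂ (b : Fin n → Y) => ∏ i, weight (W (a₁ i) (a₂ i)) (b i)) hW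
    (Real.exp_pos (n * (p.info₁ W - δ / 2))) (Real.exp_pos (n * (p.info₂ W - δ / 2)))
    (Real.exp_pos (n * (p.info₁₂ W - δ / 2)))
  have e1 : ∀ (a₂ : Fin n → X₂) (b : Fin n → Y),
      (avg P₁ fun a₁ => ∏ i, weight (W (a₁ i) (a₂ i)) (b i)) = ∏ i, p.out₁ W (q i) (a₂ i) (b i) :=
    fun a₂ b => avg_prodWeight_prod (fun i => weight (p.p₁ (q i)))
      fun i x => weight (W x (a₂ i)) (b i)
  have e2 : ∀ (a₁ : Fin n → X₁) (b : Fin n → Y),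
      (avg P₂ fun a₂ => ∏ i, weight (W (a₁ i) (a₂ i)) (b i)) = ∏ i, p.out₂ W (q i) (a₁ i) (b i) :=
    fun a₁ b => avg_prodWeight_prod (fun i => weight (p.p₂ (q i)))
      fun i x => weight (W (a₁ i) x) (b i)
  have e3 : ∀ b : Fin n → Y,
      (avg P₁ fun a₁ => ∏ i, p.out₂ W (q i) (a₁ i) (b i)) = ∏ i, p.out₁₂ W (q i) (b i) :=
    fun b => avg_prodWeight_prod (fun i => weight (p.p₁ (q i))) fun i x => p.out₂ W (q i) x (b i)
  simp only [e1, e2, e3] at hcode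
  refine ⟨⟨c₁, c₂, fun v => (d v).1, fun v => (d v).2⟩, ?_⟩
  have herr : BlockCode.errorProb ⟨c₁, c₂, fun v => (d v).1, fun v => (d v).2⟩ W =
      (∑ w₁, ∑ w₂, ∑ b, if d b = (w₁, w₂) then 0 else
        ∏ i, weight (W (c₁ w₁ i) (c₂ w₂ i)) (b i)) / (M₁ * M₂ : ℝ) := by
    simp only [BlockCode.errorProb, Prod.ext_iff]
  rw [herr]
  have := hn₁ n hn
  have g1 := hdiv hc₁
  have g2 := hdiv hc₂
  have g3 := hdiv hc₃
  refine lt_of_le_of_lt (hcode.trans ?_) this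
  linarith

end Info


/-! ## Single user codes -/

section SingleUser

variable {X₁ X₂ Y : Type*} [Fintype X₁] [Nonempty X₁] [Fintype X₂] [Nonempty X₂] [Fintype Y]
  (W : X₁ → X₂ → PMF Y)

instance {Q : Type*} [Nonempty Q] : Nonempty (InputDist Q X₁ X₂) :=
  ⟨⟨PMF.pure (Classical.arbitrary Q), fun _ => PMF.pure (Classical.arbitrary X₁),
    fun _ => PMF.pure (Classical.arbitrary X₂)⟩⟩

theorem cap₂_nonneg : 0 ≤ cap₂ W := Real.iSup_nonneg fun p => p.info₂_nonneg W

/-- `I(X₂;Y|X₁)` is an average over the letter `x₁` of the information of a single-user channel, so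
some fixed letter does at least as well as a near-optimal input distribution. -/
theorem exists_constant_blockCode {δ ε : ℝ} (hδ : 0 < δ) (hε : 0 < ε) :
    ∃ n₁ : ℕ, ∀ n ≥ n₁, ∀ L : ℕ, 0 < L → (L : ℝ) - 1 ≤ Real.exp (n * (cap₂ W - δ)) →
      ∃ B : BlockCode X₁ X₂ Y 1 L n, (∃ x, ∀ i, B.enc₁ 0 i = x) ∧ B.errorProb W < ε := by
  obtain ⟨p, hp⟩ : ∃ p : InputDist Unit X₁ X₂, cap₂ W - δ / 2 < p.info₂ W :=
    exists_lt_of_lt_ciSup (show cap₂ W - δ / 2 < cap₂ W by linarith)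
  set J : Unit → X₁ → ℝ := fun q x₁ => avg (weight (p.p₂ q)) fun x₂ =>
    ∑ y, weight (W x₁ x₂) y * Real.log (weight (W x₁ x₂) y / p.out₂ W q x₁ y) with hJ
  have hle : (avg (weight p.pQ) fun q => avg (weight (p.p₁ q)) fun x₁ => -J q x₁) ≤
      -(cap₂ W - δ / 2) := by
    have h1 : p.info₂ W = avg (weight p.pQ) fun q => avg (weight (p.p₁ q)) fun x₁ => J q x₁ :=
      p.info₂_eq_expect W
    have h2 : (avg (weight p.pQ) fun q => avg (weight (p.p₁ q)) fun x₁ => -J q x₁) =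
        -(avg (weight p.pQ) fun q => avg (weight (p.p₁ q)) fun x₁ => J q x₁) := by
      simp only [avg, mul_neg, Finset.sum_neg_distrib]
    rw [h2, ← h1]
    linarith
  obtain ⟨q, hq⟩ := exists_le_of_avg_le (weight_mem _) hle
  obtain ⟨x, hx⟩ := exists_le_of_avg_le (weight_mem _) hq
  -- The single-user channel with input 1 frozen at `x`, viewed as a two-user channel so that the
  -- coding theorem above applies.
  set W' : X₁ → X₂ → PMF Y := fun _ x₂ => W x x₂ with hW'
  set p' : InputDist Unit X₁ X₂ := ⟨p.pQ, p.p₁, fun _ => p.p₂ q⟩ with hp'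
  have hinfo : p'.info₂ W' = J q x := by
    rw [InputDist.info₂_eq_expect]
    have : (p'.expect W' fun q x₁ x₂ y =>
        Real.log (weight (W' x₁ x₂) y / p'.out₂ W' q x₁ y)) =
        avg (weight p.pQ) fun q' => avg (weight (p.p₁ q')) fun _ => J q x := rfl
    rw [this]
    simp only [avg_const (weight_mem _)]
  obtain ⟨n₁, hn₁⟩ := p'.exists_blockCode W' (half_pos hδ) hε
  refine ⟨n₁, fun n hn L hL hLe => ?_⟩
  have hLe' : (L : ℝ) - 1 ≤ Real.exp (n * (p'.info₂ W' - δ / 2)) := by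
    refine hLe.trans (Real.exp_le_exp.2 (mul_le_mul_of_nonneg_left ?_ (Nat.cast_nonneg n)))
    rw [hinfo]; linarith
  -- With one message for user 1, the factor `M₁ - 1` vanishes and two of the three rate conditions
  -- are void.
  obtain ⟨B, hB⟩ := hn₁ n hn 1 L one_pos hL (by simpa using (Real.exp_pos _).le) hLe'
    (by simpa using (Real.exp_pos _).le)
  -- Since `W'` ignores the first input, replacing the encoder of user 1 by the constant `x` and
  -- `W'` by `W` leaves the error probability unchanged, even definitionally.
  exact ⟨⟨fun _ _ => x, B.enc₂, B.dec₁, B.dec₂⟩, ⟨x, fun _ => rfl⟩, hB⟩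

end SingleUser

/-! ## The error probability of concatenated codes -/

section Concat

variable {X₁ X₂ Y : Type*} {M₁ M₂ K L m n : ℕ}

theorem concatWord_left {X : Type*} (u : Fin m → X) (v : Fin n → X) (pad : X) (i : Fin m) :
    concatWord u v pad (0 + i) = u i := by
  simp [concatWord]

theorem concatWord_right {X : Type*} (u : Fin m → X) (v : Fin n → X) (pad : X) (i : Fin n) :
    concatWord u v pad (m + i) = v i := by
  simp [concatWord]

variable [Fintype Y] [MeasurableSpace Y] [DiscreteMeasurableSpace Y]

theorem infinitePi_block_eq (P : ℕ → PMF Y) (v : Fin n → Y) :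
    (Measure.infinitePi fun i => (P i).toMeasure) {y | block m n y = v} =
      ∏ i : Fin n, P (m + i) (v i) := by
  classical
  -- Coordinate `j` is constrained only when it lies in the block; elsewhere the condition is
  -- vacuous and `t j` is everything.
  set t : ℕ → Set Y := fun j => {z | ∀ i : Fin n, m + i = j → z = v i} with ht
  have htv : ∀ i : Fin n, t (m + i) = {v i} := by
    intro i
    ext z
    simp only [ht, Set.mem_ofPred_eq, Set.mem_singleton_iff]
    refine ⟨fun h => h i rfl, fun h k hk => ?_⟩
    have : k = i := Fin.ext (by omega)
    rw [this, h]
  obtain ⟨em, hem⟩ : ∃ em : Fin n ↪ ℕ, ∀ i, em i = m + i :=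
    ⟨⟨fun i => m + i, fun i j h => Fin.ext (by simpa using h)⟩, fun _ => rfl⟩
  have hset : {y : ℕ → Y | block m n y = v} = Set.pi ↑(Finset.univ.map em) t := by
    ext y
    simp only [Set.mem_ofPred_eq, Set.mem_pi, Finset.coe_map, Finset.coe_univ, Set.image_univ,
      Set.mem_range, forall_exists_index, forall_apply_eq_imp_iff, hem, htv, Set.mem_singleton_iff]
    exact funext_iff
  rw [hset, Measure.infinitePi_pi _ fun i _ => MeasurableSet.of_discrete, Finset.prod_map]
  refine Finset.prod_congr rfl fun i _ => ?_
  simp only [hem, htv]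
  exact PMF.toMeasure_apply_singleton _ _ (MeasurableSet.singleton _)

open scoped Classical in
theorem infinitePi_block_mem_le (P : ℕ → PMF Y) (S : Set (Fin n → Y)) :
    (Measure.infinitePi fun i => (P i).toMeasure).real {y | block m n y ∈ S} ≤
      ∑ v, if v ∈ S then ∏ i : Fin n, weight (P (m + i)) (v i) else 0 := by
  set μ := Measure.infinitePi fun i => (P i).toMeasure
  have hset : {y : ℕ → Y | block m n y ∈ S} =
      ⋃ v ∈ Finset.univ.filter (· ∈ S), {y | block m n y = v} := by
    ext y
    simp
  rw [hset, ← Finset.sum_filter]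
  refine (measureReal_biUnion_finset_le _ _).trans_eq (Finset.sum_congr rfl fun v _ => ?_)
  rw [measureReal_def, infinitePi_block_eq, ENNReal.toReal_prod]
  rfl

open scoped Classical in
-- A decoding error requires an error in one of the blocks. Because `e` is a bijection, a uniform
-- message 2 gives uniform components, so the averages are those of the two block codes.
theorem errorProb_concat₁_le (W : X₁ → X₂ → PMF Y) (B : BlockCode X₁ X₂ Y M₁ K m)
    (B' : BlockCode X₁ X₂ Y 1 L n) (e : Fin M₂ ≃ Fin K × Fin L) (pad₁ : X₁) (pad₂ : X₂)
    (hM₁ : 0 < M₁) (hK : 0 < K) (hL : 0 < L) :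
    (concat₁ B B' e pad₁ pad₂).errorProb W ≤ B.errorProb W + B'.errorProb W := by
  set E : Fin M₁ → Fin K → ℝ := fun w₁ w₂ => ∑ v : Fin m → Y,
    if B.dec₁ v = w₁ ∧ B.dec₂ v = w₂ then 0 else
      ∏ i, weight (W (B.enc₁ w₁ i) (B.enc₂ w₂ i)) (v i) with hE
  set E' : Fin L → ℝ := fun w₂ => ∑ v : Fin n → Y,
    if B'.dec₁ v = 0 ∧ B'.dec₂ v = w₂ then 0 else
      ∏ i, weight (W (B'.enc₁ 0 i) (B'.enc₂ w₂ i)) (v i) with hE'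
  set V := concat₁ B B' e pad₁ pad₂ with hV
  have hpt : ∀ w₁ w₂, (V.law W w₁ w₂).real {y | V.dec₁ y ≠ w₁ ∨ V.dec₂ y ≠ w₂} ≤
      E w₁ (e w₂).1 + E' (e w₂).2 := by
    intro w₁ w₂
    have hsub : {y | V.dec₁ y ≠ w₁ ∨ V.dec₂ y ≠ w₂} ⊆
        {y | block 0 m y ∈ {v | ¬(B.dec₁ v = w₁ ∧ B.dec₂ v = (e w₂).1)}} ∪
        {y | block m n y ∈ {v | ¬(B'.dec₁ v = 0 ∧ B'.dec₂ v = (e w₂).2)}} := by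
      intro y hy
      by_contra hc
      simp only [Set.mem_union, Set.mem_ofPred_eq, not_or, not_not] at hc
      obtain ⟨⟨h1, h2⟩, -, h3⟩ := hc
      rcases hy with hy | hy
      · exact hy h1
      · refine hy ?_
        change e.symm (B.dec₂ (block 0 m y), B'.dec₂ (block m n y)) = w₂
        rw [h2, h3, Prod.mk.eta, Equiv.symm_apply_apply]
    have : IsProbabilityMeasure (V.law W w₁ w₂) := by unfold VLCode.law; infer_instance
    refine (measureReal_mono hsub).trans ((measureReal_union_le _ _).trans (add_le_add ?_ ?_))
    · refine (infinitePi_block_mem_le _ _).trans_eq (Finset.sum_congr rfl fun v _ => ?_)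
      by_cases h : B.dec₁ v = w₁ ∧ B.dec₂ v = (e w₂).1
      · rw [if_neg fun h' => h' h, if_pos h]
      · rw [if_pos (show v ∈ {v | ¬(B.dec₁ v = w₁ ∧ B.dec₂ v = (e w₂).1)} from h), if_neg h]
        simp only [hV, concat₁, concatWord_left]
    · refine (infinitePi_block_mem_le _ _).trans_eq (Finset.sum_congr rfl fun v _ => ?_)
      by_cases h : B'.dec₁ v = 0 ∧ B'.dec₂ v = (e w₂).2
      · rw [if_neg fun h' => h' h, if_pos h]
      · rw [if_pos (show v ∈ {v | ¬(B'.dec₁ v = 0 ∧ B'.dec₂ v = (e w₂).2)} from h), if_neg h]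
        simp only [hV, concat₁, concatWord_right]
  have hM₂ : M₂ = K * L := by
    have := Fintype.card_congr e
    simpa using this
  have hK' : (0 : ℝ) < K := Nat.cast_pos.2 hK
  have hL' : (0 : ℝ) < L := Nat.cast_pos.2 hL
  have hM₁' : (0 : ℝ) < M₁ := Nat.cast_pos.2 hM₁
  have hsum : ∑ w₁, ∑ w₂, (E w₁ (e w₂).1 + E' (e w₂).2) =
      L * ∑ w₁, ∑ k, E w₁ k + M₁ * K * ∑ l, E' l := by
    have : ∀ w₁, ∑ w₂, (E w₁ (e w₂).1 + E' (e w₂).2) = L * ∑ k, E w₁ k + K * ∑ l, E' l := by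
      intro w₁
      rw [Equiv.sum_comp e fun kl : Fin K × Fin L => E w₁ kl.1 + E' kl.2, Fintype.sum_prod_type]
      simp [Finset.sum_add_distrib, Finset.mul_sum]
    simp only [this, Finset.sum_add_distrib, ← Finset.mul_sum, Finset.sum_const,
      Finset.card_univ, Fintype.card_fin, nsmul_eq_mul]
    ring
  have hB : B.errorProb W = (∑ w₁, ∑ k, E w₁ k) / (M₁ * K : ℝ) := rfl
  have hB' : B'.errorProb W = (∑ l, E' l) / L := by
    simp only [BlockCode.errorProb, Finset.univ_unique, Finset.sum_singleton, Nat.cast_one, one_mul]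
    rfl
  rw [hB, hB', VLCode.errorProb]
  calc _ ≤ (L * ∑ w₁, ∑ k, E w₁ k + M₁ * K * ∑ l, E' l) / ((M₁ : ℝ) * (M₂ : ℝ)) := by
        rw [← hsum]
        gcongr
        exact hpt _ _
    _ = _ := by
        rw [hM₂, Nat.cast_mul]
        field_simp

theorem VLCode.mean_const (V : VLCode X₁ X₂ Y M₁ M₂) (W : X₁ → X₂ → PMF Y) (hM₁ : 0 < M₁)
    (hM₂ : 0 < M₂) (k : ℕ) : V.mean W (fun _ => (k : ℕ∞)) = k := by
  have h : ∀ w₁ w₂, ∫⁻ _, (((k : ℕ∞) : ℕ∞) : ℝ≥0∞) ∂(V.law W w₁ w₂) = k := by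
    intro w₁ w₂
    have : IsProbabilityMeasure (V.law W w₁ w₂) := by unfold VLCode.law; infer_instance
    simp
  simp only [VLCode.mean, h, Finset.sum_const, Finset.card_univ, Fintype.card_fin, nsmul_eq_mul]
  rw [← mul_assoc, mul_comm, ENNReal.mul_div_cancel_right]
  · simp [hM₁.ne', hM₂.ne']
  · exact ENNReal.mul_ne_top (ENNReal.natCast_ne_top _) (ENNReal.natCast_ne_top _)

end Concat

/-! ## Existence of concatenated codes -/

section ExistsConcat

variable {X₁ X₂ Y : Type*} [Fintype X₁] [Nonempty X₁] [Fintype X₂] [Nonempty X₂] [Fintype Y]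
  [MeasurableSpace Y] [DiscreteMeasurableSpace Y] (W : X₁ → X₂ → PMF Y)

/-- The threshold `n₁` depends only on `p`, `δ` and `ε`, so lengths and message sizes may be fitted
to each other afterwards. The second block must be empty or long. -/
theorem exists_mem_concatCodes₁ (p : InputDist (Fin 2) X₁ X₂) {δ ε : ℝ} (hδ : 0 < δ)
    (hε : 0 < ε) :
    ∃ n₁ : ℕ, ∀ m ≥ n₁, ∀ n : ℕ, n = 0 ∨ n₁ ≤ n → ∀ M₁ K L : ℕ, 0 < M₁ → 0 < K → 0 < L →
      (M₁ : ℝ) - 1 ≤ Real.exp (m * (p.info₁ W - δ)) →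
      (K : ℝ) - 1 ≤ Real.exp (m * (p.info₂ W - δ)) →
      ((M₁ : ℝ) - 1) * ((K : ℝ) - 1) ≤ Real.exp (m * (p.info₁₂ W - δ)) →
      (L : ℝ) - 1 ≤ Real.exp (n * (cap₂ W - δ)) →
      ∀ (T : Set (ℝ × ℝ)) (η : ℝ) (n₀ : ℕ), n₀ < m → (Real.log M₁ / m, Real.log K / m) ∈ T →
      n * (cap₂ W - η) ≤ Real.log L → Real.log L ≤ n * cap₂ W →
      ∃ V ∈ concatCodes₁ W T η n₀ M₁ (K * L), V.N₁ = (fun _ => (m : ℕ∞)) ∧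
        V.N₂ = (fun _ => ((m + n : ℕ) : ℕ∞)) ∧ V.errorProb W < ε := by
  obtain ⟨n₁, h₁⟩ := p.exists_blockCode W hδ (half_pos hε)
  obtain ⟨n₂, h₂⟩ := exists_constant_blockCode W hδ (half_pos hε)
  refine ⟨max n₁ n₂, fun m hm n hn M₁ K L hM₁ hK hL c₁ c₂ c₃ c₄ T η n₀ hn₀ hT hη hη' => ?_⟩
  obtain ⟨B, hB⟩ := h₁ m (le_of_max_le_left hm) M₁ K hM₁ hK c₁ c₂ c₃
  obtain ⟨B', hx, hB'⟩ : ∃ B' : BlockCode X₁ X₂ Y 1 L n, (∃ x, ∀ i, B'.enc₁ 0 i = x) ∧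
      B'.errorProb W < ε / 2 := by
    rcases hn with rfl | hn
    -- For an empty block the upper rate bound reads `log L ≤ 0`, so there is a single message and
    -- no error.
    · have hL1 : L = 1 := by
        have : Real.log L ≤ 0 := by simpa using hη'
        have hL' : (0 : ℝ) < L := Nat.cast_pos.2 hL
        have : (L : ℝ) ≤ 1 := by
          by_contra! h
          linarith [Real.log_pos h]
        have : L ≤ 1 := by exact_mod_cast this
        omega
      subst hL1
      refine ⟨⟨fun _ i => i.elim0, fun _ i => i.elim0, fun _ => 0, fun _ => 0⟩,
        ⟨Classical.arbitrary X₁, fun i => i.elim0⟩, ?_⟩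
      simp only [BlockCode.errorProb]
      simpa using hε
    · exact h₂ n (le_of_max_le_right hn) L hL c₄
  refine ⟨concat₁ B B' finProdFinEquiv.symm (Classical.arbitrary X₁) (Classical.arbitrary X₂),
    ⟨K, L, m, n, B, B', finProdFinEquiv.symm, _, _, hn₀, hT, hη, hη', hx, rfl⟩, rfl, rfl, ?_⟩
  have := errorProb_concat₁_le W B B' finProdFinEquiv.symm (Classical.arbitrary X₁)
    (Classical.arbitrary X₂) hM₁ hK hL
  linarith

end ExistsConcat

/-! ## Codes with the users exchanged -/

section Swap

variable {X₁ X₂ Y : Type*} {M₁ M₂ K L m n : ℕ}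

/-- The block code with the users exchanged. -/
def BlockCode.swap (B : BlockCode X₁ X₂ Y M₁ M₂ n) : BlockCode X₂ X₁ Y M₂ M₁ n :=
  ⟨B.enc₂, B.enc₁, B.dec₂, B.dec₁⟩

/-- The variable length code with the users exchanged. -/
def VLCode.swap (V : VLCode X₁ X₂ Y M₁ M₂) : VLCode X₂ X₁ Y M₂ M₁ where
  enc₁ := V.enc₂
  enc₂ := V.enc₁
  N₁ := V.N₂
  N₂ := V.N₁
  dec₁ := V.dec₂
  dec₂ := V.dec₁
  stop₁ := V.stop₂
  stop₂ := V.stop₁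
  adapted₁ := V.adapted₂
  adapted₂ := V.adapted₁

theorem VLCode.errorProb_swap [MeasurableSpace Y] (V : VLCode X₁ X₂ Y M₁ M₂)
    (W : X₁ → X₂ → PMF Y) : V.swap.errorProb (swapChannel W) = V.errorProb W := by
  simp only [VLCode.errorProb]
  rw [Finset.sum_comm, mul_comm]
  have : ∀ w₁ w₂, (V.swap.law (swapChannel W) w₂ w₁).real
      {y | V.swap.dec₁ y ≠ w₂ ∨ V.swap.dec₂ y ≠ w₁} =
      (V.law W w₁ w₂).real {y | V.dec₁ y ≠ w₁ ∨ V.dec₂ y ≠ w₂} := by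
    intro w₁ w₂
    simp only [or_comm (a := V.dec₁ _ ≠ w₁)]
    rfl
  simp only [this]

variable [Fintype X₁] [Fintype X₂] [Fintype Y] (W : X₁ → X₂ → PMF Y)

theorem cap₁_swap : cap₁ (swapChannel W) = cap₂ W :=
  (Function.Surjective.iSup_congr (f := fun p : InputDist Unit X₁ X₂ => p.info₂ W)
    (g := fun p : InputDist Unit X₂ X₁ => p.info₁ (swapChannel W)) InputDist.swap
    (fun p => ⟨p.swap, rfl⟩) fun p => p.info₁_swap W).symm

theorem cap₂_swap : cap₂ (swapChannel W) = cap₁ W :=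
  (Function.Surjective.iSup_congr (f := fun p : InputDist Unit X₁ X₂ => p.info₁ W)
    (g := fun p : InputDist Unit X₂ X₁ => p.info₂ (swapChannel W)) InputDist.swap
    (fun p => ⟨p.swap, rfl⟩) fun p => p.info₂_swap W).symm

theorem mem_regionMAC_swap {R : ℝ × ℝ} (h : R ∈ regionMAC W) :
    R.swap ∈ regionMAC (swapChannel W) := by
  obtain ⟨h1, h2, p, hp1, hp2, hp3⟩ := h
  refine ⟨h2, h1, p.swap, ?_, ?_, ?_⟩
  · rwa [InputDist.info₁_swap]
  · rwa [InputDist.info₂_swap]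
  · rw [InputDist.info₁₂_swap, add_comm]; exact hp3

/-- Exchanging the users turns codes `V¹` into codes `V²`, so only the former need to be
constructed. -/
theorem swap_mem_concatCodes₂ {T : Set (ℝ × ℝ)} {η : ℝ} {n₀ : ℕ} {V : VLCode X₂ X₁ Y M₂ M₁}
    (h : V ∈ concatCodes₁ (swapChannel W) (Prod.swap ⁻¹' T) η n₀ M₂ M₁) :
    V.swap ∈ concatCodes₂ W T η n₀ M₁ M₂ := by
  obtain ⟨K, L, m, n, B, B', e, pad₁, pad₂, h1, h2, h3, h4, h5, rfl⟩ := h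
  rw [cap₂_swap] at h3 h4
  exact ⟨K, L, m, n, B.swap, B'.swap, e, pad₂, pad₁, h1, h2, h3, h4, h5, rfl⟩

theorem mem_outerRegion_swap {R : ℝ × ℝ} {r₁ r₂ : ℝ} (h : R ∈ outerRegion W r₁ r₂) :
    R.swap ∈ outerRegion (swapChannel W) r₂ r₁ := by
  obtain ⟨h1, h2, p, hp1, hp2, hp3⟩ := h
  refine ⟨h2, h1, p.swap, ?_, ?_, ?_⟩
  · rwa [InputDist.info₁_swap, cap₁_swap]
  · rwa [InputDist.info₂_swap, cap₂_swap]
  · rw [InputDist.info₁₂_swap, cap₁_swap, cap₂_swap]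
    simp only [Prod.fst_swap, Prod.snd_swap]
    linarith

theorem IsPentagon.swap {d₁ d₂ : ℝ} (h : IsPentagon W d₁ d₂) :
    IsPentagon (swapChannel W) d₂ d₁ := by
  obtain ⟨h1, h2, h3, h4, h5, h6⟩ := h
  refine ⟨h3, (cap₁_swap W).symm ▸ h4, h1, (cap₂_swap W).symm ▸ h2, ?_, ?_⟩
  · rw [cap₁_swap, cap₂_swap]; linarith
  · ext R
    have : R ∈ regionMAC (swapChannel W) ↔ R.swap ∈ regionMAC W :=
      ⟨fun h => mem_regionMAC_swap (swapChannel W) h, fun h => mem_regionMAC_swap W h⟩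
    rw [this, h6, cap₁_swap, cap₂_swap]
    simp only [Set.mem_ofPred_eq, Prod.fst_swap, Prod.snd_swap]
    constructor
    · rintro ⟨a, b, c, d, e⟩; exact ⟨c, d, a, b, by linarith⟩
    · rintro ⟨a, b, c, d, e⟩; exact ⟨c, d, a, b, by linarith⟩

end Swap


/-! ## Message sets of a given rate -/

/-- The size of a message set with logarithm about `max x 0`. -/
def messageSize (x : ℝ) : ℕ := max 1 ⌊Real.exp x⌋₊

theorem messageSize_pos (x : ℝ) : 0 < messageSize x := lt_of_lt_of_le one_pos (le_max_left _ _)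

/-- Valid for negative `x` too, when there is one message. This is why the coding theorem bounds `M
- 1` rather than `M`: rates below `δ` need no separate treatment. -/
theorem messageSize_sub_one_le (x : ℝ) : (messageSize x : ℝ) - 1 ≤ Real.exp x := by
  have h := Real.exp_pos x
  have h1 := Nat.floor_le h.le
  rw [messageSize, Nat.cast_max, Nat.cast_one]
  rcases max_cases (1 : ℝ) ⌊Real.exp x⌋₊ with h2 | h2 <;> rw [h2.1] <;> linarith

theorem messageSize_sub_one_nonneg (x : ℝ) : 0 ≤ (messageSize x : ℝ) - 1 := by
  have : (1 : ℝ) ≤ messageSize x := by exact_mod_cast messageSize_pos x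
  linarith

theorem log_messageSize_le {x z : ℝ} (hz : 0 ≤ z) (h : x ≤ z) : Real.log (messageSize x) ≤ z := by
  rw [Real.log_le_iff_le_exp (by exact_mod_cast messageSize_pos x), messageSize, Nat.cast_max,
    Nat.cast_one]
  exact max_le (Real.one_le_exp hz)
    ((Nat.floor_le (Real.exp_pos x).le).trans (Real.exp_le_exp.2 h))

/-- Rounding costs at most a factor `2`, since `exp x < ⌊exp x⌋ + 1` and both summands are at most
the message size. -/
theorem le_log_messageSize (x : ℝ) : x - Real.log 2 ≤ Real.log (messageSize x) := by
  have hpos : (0 : ℝ) < messageSize x := by exact_mod_cast messageSize_pos x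
  rw [Real.le_log_iff_exp_le hpos, Real.exp_sub, Real.exp_log two_pos,
    div_le_iff₀ two_pos]
  have h1 : (1 : ℝ) ≤ messageSize x := by exact_mod_cast messageSize_pos x
  have h2 : Real.exp x < ⌊Real.exp x⌋₊ + 1 := Nat.lt_floor_add_one _
  have h3 : (⌊Real.exp x⌋₊ : ℝ) ≤ messageSize x := by exact_mod_cast le_max_right _ _
  linarith

theorem eventually_le_natCast_mul (a : ℝ) {c : ℝ} (hc : 0 < c) : ∀ᶠ m : ℕ in atTop, a ≤ m * c :=
  (tendsto_natCast_atTop_atTop.atTop_mul_const hc).eventually_ge_atTop a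

/-! ## Achievability with deterministic codes -/

section Deterministic

variable {X₁ X₂ Y : Type*} [Fintype X₁] [Nonempty X₁] [Fintype X₂] [Nonempty X₂] [Fintype Y]
  [MeasurableSpace Y] [DiscreteMeasurableSpace Y] (W : X₁ → X₂ → PMF Y)

theorem min_natCast_add (m n : ℕ) : min (m : ℕ∞) ((m + n : ℕ) : ℕ∞) = m :=
  min_eq_left (by exact_mod_cast Nat.le_add_right m n)

/-- User 2 sends at rate `S` in the first block and near `C₂` in the second, with lengths in the
ratio `r : 1 - r`. The defining inequalities of the outer region say exactly that a suitable `S`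
exists. -/
theorem exists_concatCodes₁_of_mem_outerRegion {r η δ ε : ℝ} (hr : 0 < r) (hr1 : r ≤ 1)
    (hη : 0 < η) (hδ : 0 < δ) (hε : 0 < ε) (n₀ : ℕ) {R : ℝ × ℝ} (hR : R ∈ outerRegion W 1 r) :
    ∃ (M₁ M₂ m n : ℕ), ∃ V ∈ concatCodes₁ W (regionMAC W) η n₀ M₁ M₂, 0 < M₁ ∧ 0 < M₂ ∧
      0 < m ∧ V.N₁ = (fun _ => (m : ℕ∞)) ∧ V.N₂ = (fun _ => ((m + n : ℕ) : ℕ∞)) ∧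
      r * (m + n) ≤ m ∧ m * (R.1 - δ) ≤ Real.log M₁ ∧ (m + n) * (R.2 - δ) ≤ Real.log M₂ ∧
      V.errorProb W < ε := by
  obtain ⟨h01, h02, p, hp1, hp2, hp3⟩ := hR
  obtain ⟨R₁, R₂⟩ := R
  simp only [one_mul, sub_self, zero_mul, add_zero, mul_zero] at h01 h02 hp1 hp2 hp3 ⊢
  set C := cap₂ W
  have hC : 0 ≤ C := cap₂_nonneg W
  obtain ⟨S, hS0, hS1, hS2, hS3⟩ : ∃ S : ℝ, 0 ≤ S ∧ S ≤ p.info₂ W ∧ R₁ + S ≤ p.info₁₂ W ∧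
      R₂ ≤ r * S + (1 - r) * C := by
    -- The smallest admissible `S`. If it is `0`, the sum constraint follows from `I₁ ≤ I₁₂`;
    -- otherwise it is the third inequality of the outer region.
    refine ⟨max 0 ((R₂ - (1 - r) * C) / r), le_max_left _ _, max_le (p.info₂_nonneg W) ?_, ?_, ?_⟩
    · rw [div_le_iff₀ hr]; linarith
    · rw [← le_sub_iff_add_le']
      refine max_le ?_ ?_
      · linarith [p.info₁_le_info₁₂ W]
      · rw [div_le_iff₀ hr]; linarith
    · have : (R₂ - (1 - r) * C) / r * r = R₂ - (1 - r) * C := div_mul_cancel₀ _ hr.ne'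
      have h2 := mul_le_mul_of_nonneg_left (le_max_right 0 ((R₂ - (1 - r) * C) / r)) hr.le
      linarith
  -- The codes back off by `κ`, strictly less than the allowed losses `δ` and `η`; the remaining
  -- margins absorb all rounding.
  set κ := min δ η / 2 with hκ
  have hκ0 : 0 < κ := by positivity
  have hκδ : 0 < δ - κ := by have := min_le_left δ η; linarith
  have hκη : 0 < η - κ := by have := min_le_right δ η; linarith
  obtain ⟨n₁, hn₁⟩ := exists_mem_concatCodes₁ W p hκ0 hε
  -- Rounding down keeps `r (m + n) ≤ m`, as the ratio condition demands.
  set len : ℕ → ℕ := fun m => ⌊m * ((1 - r) / r)⌋₊ with hlen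
  have hr' : 0 ≤ (1 - r) / r := div_nonneg (by linarith) hr.le
  have hn : ∀ n' : ℕ, ∀ᶠ m : ℕ in atTop, len m = 0 ∨ n' ≤ len m := by
    intro n'
    rcases hr1.eq_or_lt with h | h
    · exact Eventually.of_forall fun m => Or.inl (by simp [hlen, h])
    · have : 0 < (1 - r) / r := div_pos (by linarith) hr
      filter_upwards [eventually_le_natCast_mul n' this] with m hm
      exact Or.inr (Nat.le_floor hm)
  obtain ⟨n₂, hn₂⟩ := eventually_atTop.1 (eventually_le_natCast_mul (Real.log 2) hκη)
  obtain ⟨m, hm1, hm2, hm3, hm4, hm5, hm6⟩ := ((hn n₁).and ((hn n₂).and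
    ((eventually_ge_atTop n₁).and ((eventually_gt_atTop n₀).and
    ((eventually_le_natCast_mul (Real.log 2) hκδ).and
      -- Rounding `n` costs user 2 at most `C`, and rounding its two message sizes at most `log 2`
      -- each.
      (eventually_le_natCast_mul (C + 2 * Real.log 2) hκδ)))))).exists
  have hm0 : 0 < m := by omega
  have hmR : (0 : ℝ) < m := by exact_mod_cast hm0
  obtain ⟨n, hnm⟩ : ∃ n, n = len m := ⟨_, rfl⟩
  rw [← hnm] at hm1 hm2
  have hnle : (n : ℝ) * r ≤ m * (1 - r) := by
    have : (n : ℝ) ≤ m * ((1 - r) / r) := by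
      rw [hnm]; exact Nat.floor_le (by positivity)
    rw [← mul_div_assoc, le_div_iff₀ hr] at this
    exact this
  have hnge : (m : ℝ) * (1 - r) ≤ (n + 1) * r := by
    have : m * ((1 - r) / r) < (n : ℝ) + 1 := by
      rw [hnm]; exact Nat.lt_floor_add_one _
    rw [← mul_div_assoc, div_lt_iff₀ hr] at this
    exact this.le
  have hmC : ∀ x y : ℝ, x ≤ y → m * (x - κ) ≤ m * y := fun x y h =>
    mul_le_mul_of_nonneg_left (by linarith) hmR.le
  have hn0 : (0 : ℝ) ≤ n := Nat.cast_nonneg n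
  have hlog2 : 0 ≤ Real.log 2 := Real.log_nonneg one_le_two
  have hL : n * (C - η) ≤ Real.log (messageSize (n * (C - κ))) := by
    rcases hm2 with h | h
    · rw [h]; simpa using Real.log_natCast_nonneg _
    · have h1 := hn₂ n h
      have h2 := le_log_messageSize (n * (C - κ))
      linarith
  have hL' : Real.log (messageSize (n * (C - κ))) ≤ n * C :=
    log_messageSize_le (by positivity) (mul_le_mul_of_nonneg_left (by linarith) hn0)
  have hlog : ∀ x, 0 ≤ x → Real.log (messageSize (m * (x - κ))) ≤ m * x := fun x hx =>
    log_messageSize_le (by positivity) (hmC x x le_rfl)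
  have hcode := hn₁ m hm3 n hm1 (messageSize (m * (R₁ - κ))) (messageSize (m * (S - κ)))
    (messageSize (n * (C - κ))) (messageSize_pos _) (messageSize_pos _) (messageSize_pos _)
    ((messageSize_sub_one_le _).trans (Real.exp_le_exp.2
      (mul_le_mul_of_nonneg_left (by linarith) hmR.le)))
    ((messageSize_sub_one_le _).trans (Real.exp_le_exp.2
      (mul_le_mul_of_nonneg_left (by linarith) hmR.le)))
    (by
      refine (mul_le_mul (messageSize_sub_one_le _) (messageSize_sub_one_le _)
        (messageSize_sub_one_nonneg _) (Real.exp_pos _).le).trans ?_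
      rw [← Real.exp_add, ← mul_add]
      exact Real.exp_le_exp.2 (mul_le_mul_of_nonneg_left (by linarith) hmR.le))
    (messageSize_sub_one_le _) (regionMAC W) η n₀ hm4
    (by
      have g1 : Real.log (messageSize (m * (R₁ - κ))) / m ≤ R₁ := by
        rw [div_le_iff₀' hmR]; exact hlog _ h01
      have g2 : Real.log (messageSize (m * (S - κ))) / m ≤ S := by
        rw [div_le_iff₀' hmR]; exact hlog _ hS0
      exact ⟨div_nonneg (Real.log_natCast_nonneg _) hmR.le,
        div_nonneg (Real.log_natCast_nonneg _) hmR.le, p, by dsimp only; linarith,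
        by dsimp only; linarith, by dsimp only; linarith⟩) hL hL'
  obtain ⟨V, hV, hN₁, hN₂, herr⟩ := hcode
  refine ⟨_, _, m, n, V, hV, messageSize_pos _, Nat.mul_pos (messageSize_pos _) (messageSize_pos _),
    hm0, hN₁, hN₂, by linarith, ?_, ?_, herr⟩
  · have := le_log_messageSize (m * (R₁ - κ))
    linarith
  · have g1 := le_log_messageSize (m * (S - κ))
    have g2 := le_log_messageSize (n * (C - κ))
    have h0 : ∀ x, ((messageSize x : ℕ) : ℝ) ≠ 0 := fun x => by
      exact_mod_cast (messageSize_pos x).ne'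
    rw [Nat.cast_mul, Real.log_mul (h0 _) (h0 _)]
    have g3 : 0 ≤ (m * (1 - r) - n * r) * S := mul_nonneg (by linarith) hS0
    have g4 : (m * (1 - r) - n * r) * C ≤ 1 * C :=
      mul_le_mul_of_nonneg_right (by linarith) hC
    have g5 : (m + n : ℝ) * R₂ ≤ (m + n) * (r * S + (1 - r) * C) :=
      mul_le_mul_of_nonneg_left hS3 (by positivity)
    have g6 : 0 ≤ n * (δ - κ) := mul_nonneg hn0 hκδ.le
    linarith

theorem VLCode.meanN₁_det {M₁ M₂ : ℕ} (V : VLCode X₁ X₂ Y M₁ M₂) :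
    V.det.meanN₁ W = V.mean W V.N₁ := by
  change ∑ _k : Fin 1, ((1 : ℝ≥0) : ℝ≥0∞) * V.mean W V.N₁ = _
  simp

theorem VLCode.meanN₂_det {M₁ M₂ : ℕ} (V : VLCode X₁ X₂ Y M₁ M₂) :
    V.det.meanN₂ W = V.mean W V.N₂ := by
  change ∑ _k : Fin 1, ((1 : ℝ≥0) : ℝ≥0∞) * V.mean W V.N₂ = _
  simp

theorem VLCode.meanN_det {M₁ M₂ : ℕ} (V : VLCode X₁ X₂ Y M₁ M₂) :
    V.det.meanN W = V.mean W fun y => min (V.N₁ y) (V.N₂ y) := by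
  change ∑ _k : Fin 1, ((1 : ℝ≥0) : ℝ≥0∞) * V.mean W (fun y => min (V.N₁ y) (V.N₂ y)) = _
  simp

theorem VLCode.errorProb_det {M₁ M₂ : ℕ} (V : VLCode X₁ X₂ Y M₁ M₂) :
    V.det.errorProb W = V.errorProb W := by
  change ∑ _k : Fin 1, ((1 : ℝ≥0) : ℝ) * V.errorProb W = _
  simp

theorem VLCode.mean_swap {M₁ M₂ : ℕ} (V : VLCode X₂ X₁ Y M₂ M₁) (T : (ℕ → Y) → ℕ∞) :
    V.swap.mean W T = V.mean (swapChannel W) T := by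
  simp only [VLCode.mean]
  rw [Finset.sum_comm, mul_comm]
  rfl

theorem det_mem_achievableBy {S : ∀ M₁ M₂ : ℕ, Set (RandVLCode X₁ X₂ Y M₁ M₂)} {r₁ r₂ : ℝ}
    {R : ℝ × ℝ} (h : ∀ ε > 0, ∃ (M₁ M₂ l₁ l₂ : ℕ), ∃ V : VLCode X₁ X₂ Y M₁ M₂, V.det ∈ S M₁ M₂ ∧
      0 < M₁ ∧ 0 < M₂ ∧ 0 < l₁ ∧ 0 < l₂ ∧
      V.N₁ = (fun _ => (l₁ : ℕ∞)) ∧ V.N₂ = (fun _ => (l₂ : ℕ∞)) ∧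
      r₁ * l₁ ≤ min l₁ l₂ ∧ r₂ * l₂ ≤ min l₁ l₂ ∧
      l₁ * R.1 ≤ Real.log M₁ ∧ l₂ * R.2 ≤ Real.log M₂ ∧ V.errorProb W < ε) :
    R ∈ achievableBy W S r₁ r₂ := by
  intro ε hε
  obtain ⟨M₁, M₂, l₁, l₂, V, hVS, hM₁, hM₂, hl₁, hl₂, hN₁, hN₂, hr₁, hr₂, hR₁, hR₂, herr⟩ := h ε hε
  have e1 : V.det.meanN₁ W = l₁ := by
    rw [VLCode.meanN₁_det, hN₁, VLCode.mean_const V W hM₁ hM₂]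
  have e2 : V.det.meanN₂ W = l₂ := by
    rw [VLCode.meanN₂_det, hN₂, VLCode.mean_const V W hM₁ hM₂]
  have e3 : V.det.meanN W = (min l₁ l₂ : ℕ) := by
    rw [← VLCode.mean_const V W hM₁ hM₂, VLCode.meanN_det, hN₁, hN₂]
    rcases le_total l₁ l₂ with hl | hl
    · rw [min_eq_left hl]
      simp only [min_eq_left (show (l₁ : ℕ∞) ≤ l₂ from by exact_mod_cast hl)]
    · rw [min_eq_right hl]
      simp only [min_eq_right (show (l₂ : ℕ∞) ≤ l₁ from by exact_mod_cast hl)]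
  have hl₁' : (0 : ℝ) < l₁ := by exact_mod_cast hl₁
  have hl₂' : (0 : ℝ) < l₂ := by exact_mod_cast hl₂
  refine ⟨M₁, M₂, V.det, hVS, ?_⟩
  rw [e1, e2, e3, VLCode.errorProb_det]
  simp only [ENNReal.toReal_natCast]
  refine ⟨by exact_mod_cast hl₁.ne', ENNReal.natCast_ne_top _, by exact_mod_cast hl₂.ne',
    ENNReal.natCast_ne_top _, ?_, ?_, ?_, ?_, herr⟩
  · rw [le_div_iff₀ hl₁']; exact_mod_cast hr₁
  · rw [le_div_iff₀ hl₂']; exact_mod_cast hr₂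
  · rwa [le_div_iff₀' hl₁']
  · rwa [le_div_iff₀' hl₂']

theorem achievableBy_mono {S S' : ∀ M₁ M₂ : ℕ, Set (RandVLCode X₁ X₂ Y M₁ M₂)} {r₁ r₂ r₁' r₂' : ℝ}
    (hS : ∀ M₁ M₂, S M₁ M₂ ⊆ S' M₁ M₂) (h₁ : r₁' ≤ r₁) (h₂ : r₂' ≤ r₂) :
    achievableBy W S r₁ r₂ ⊆ achievableBy W S' r₁' r₂' := by
  intro R hR ε hε
  obtain ⟨M₁, M₂, V, hV, a, b, c, d, e, f, g⟩ := hR ε hε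
  exact ⟨M₁, M₂, V, hS _ _ hV, a, b, c, d, h₁.trans e, h₂.trans f, g⟩

theorem mem_closure_of_forall_sub_mem {A : Set (ℝ × ℝ)} {R : ℝ × ℝ}
    (h : ∀ δ > 0, (R.1 - δ, R.2 - δ) ∈ A) : R ∈ closure A := by
  have hc : Tendsto (fun δ : ℝ => (R.1 - δ, R.2 - δ)) (𝓝[>] 0) (𝓝 R) := by
    have : Continuous fun δ : ℝ => (R.1 - δ, R.2 - δ) := by fun_prop
    have := (this.tendsto 0).mono_left (nhdsWithin_le_nhds (s := Set.Ioi 0))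
    simpa using this
  exact mem_closure_of_tendsto hc (eventually_nhdsWithin_of_forall h)

theorem outerRegion_subset_of_pos {r η : ℝ} (hr : 0 < r) (hr1 : r ≤ 1) (hη : 0 < η) (n₀ : ℕ) :
    outerRegion W 1 r ⊆ closure (achievableBy W
      (fun M₁ M₂ => VLCode.det '' concatCodes₁ W (regionMAC W) η n₀ M₁ M₂) 1 r) := by
  intro R hR
  refine mem_closure_of_forall_sub_mem fun δ hδ => det_mem_achievableBy W fun ε hε => ?_
  obtain ⟨M₁, M₂, m, n, V, hV, hM₁, hM₂, hm, hN₁, hN₂, h1, h2, h3, h4⟩ :=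
    exists_concatCodes₁_of_mem_outerRegion W hr hr1 hη hδ hε n₀ hR
  refine ⟨M₁, M₂, m, m + n, V, ⟨V, hV, rfl⟩, hM₁, hM₂, hm, by omega, hN₁, hN₂, ?_, ?_, h2, ?_, h4⟩
  · simp
  · simpa using h1
  · simpa using h3

/-- No finite second block gives `N / N₂ = 0`, but the ratios are only bounded below. A point for
ratio `0` is the limit of `(R₁, (1 - r) R₂)`, which lies in the outer region for `r > 0` by `I₁ ≤
I₁₂`. -/
theorem outerRegion_subset₁ {r η : ℝ} (hr : 0 ≤ r) (hr1 : r ≤ 1) (hη : 0 < η) (n₀ : ℕ) :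
    outerRegion W 1 r ⊆ closure (achievableBy W
      (fun M₁ M₂ => VLCode.det '' concatCodes₁ W (regionMAC W) η n₀ M₁ M₂) 1 r) := by
  rcases hr.eq_or_lt with rfl | hr
  swap
  · exact outerRegion_subset_of_pos W hr hr1 hη n₀
  intro R hR
  set A := achievableBy W
    (fun M₁ M₂ => VLCode.det '' concatCodes₁ W (regionMAC W) η n₀ M₁ M₂) 1 0
  have hmem : ∀ r ∈ Set.Ioc (0 : ℝ) 1, (R.1, (1 - r) * R.2) ∈ closure A := by
    rintro r ⟨hr0, hr1⟩
    refine closure_mono (achievableBy_mono W (fun _ _ => le_rfl) le_rfl hr0.le)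
      (outerRegion_subset_of_pos W hr0 hr1 hη n₀ ?_)
    obtain ⟨h01, h02, p, hp1, hp2, -⟩ := hR
    simp only [one_mul, sub_self, zero_mul, add_zero, sub_zero, zero_add] at hp1 hp2
    have h3 := p.info₁_le_info₁₂ W
    have h4 := p.info₂_nonneg W
    have h5 : (1 - r) * R.2 ≤ (1 - r) * cap₂ W := mul_le_mul_of_nonneg_left hp2 (by linarith)
    have h6 : r * R.1 ≤ r * p.info₁₂ W := mul_le_mul_of_nonneg_left (by linarith) hr0.le
    refine ⟨h01, mul_nonneg (by linarith) h02, p, ?_, ?_, ?_⟩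
    · simpa using hp1
    · have := mul_nonneg hr0.le h4
      dsimp only
      linarith
    · simp only [one_mul, sub_self, zero_mul, add_zero, mul_zero]
      linarith
  have hc : Tendsto (fun r : ℝ => (R.1, (1 - r) * R.2)) (𝓝[>] 0) (𝓝 R) := by
    have : Continuous fun r : ℝ => (R.1, (1 - r) * R.2) := by fun_prop
    have := (this.tendsto 0).mono_left (nhdsWithin_le_nhds (s := Set.Ioi 0))
    simpa using this
  refine isClosed_closure.mem_of_tendsto hc ?_
  filter_upwards [Ioc_mem_nhdsGT (zero_lt_one' ℝ)] with r hr using hmem r hr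

theorem achievableBy_swap {r₁ r₂ : ℝ}
    {S : ∀ M₁ M₂ : ℕ, Set (VLCode X₁ X₂ Y M₁ M₂)} {S' : ∀ M₁ M₂ : ℕ, Set (VLCode X₂ X₁ Y M₁ M₂)}
    (hS : ∀ M₁ M₂, ∀ V ∈ S' M₂ M₁, V.swap ∈ S M₁ M₂) {R : ℝ × ℝ}
    (hR : R ∈ achievableBy (swapChannel W) (fun M₁ M₂ => VLCode.det '' S' M₁ M₂) r₂ r₁) :
    R.swap ∈ achievableBy W (fun M₁ M₂ => VLCode.det '' S M₁ M₂) r₁ r₂ := by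
  intro ε hε
  obtain ⟨M₁, M₂, V, ⟨V, hV, rfl⟩, a, b, c, d, e, f, g, h, i⟩ := hR ε hε
  have e3 : (fun y => min (V.swap.N₁ y) (V.swap.N₂ y)) = fun y => min (V.N₁ y) (V.N₂ y) :=
    funext fun y => min_comm _ _
  refine ⟨M₂, M₁, V.swap.det, ⟨V.swap, hS _ _ V hV, rfl⟩, ?_⟩
  rw [VLCode.meanN₁_det, VLCode.meanN₂_det, VLCode.meanN_det, e3, VLCode.errorProb_det,
    VLCode.mean_swap, VLCode.mean_swap, VLCode.mean_swap]
  rw [VLCode.meanN₁_det] at a b e g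
  rw [VLCode.meanN₂_det] at c d f h
  rw [VLCode.meanN_det] at e f
  rw [VLCode.errorProb_det, ← VLCode.errorProb_swap] at i
  exact ⟨c, d, a, b, f, e, h, g, i⟩

theorem outerRegion_subset₂ {r η : ℝ} (hr : 0 ≤ r) (hr1 : r ≤ 1) (hη : 0 < η) (n₀ : ℕ) :
    outerRegion W r 1 ⊆ closure (achievableBy W
      (fun M₁ M₂ => VLCode.det '' concatCodes₂ W (regionMAC W) η n₀ M₁ M₂) r 1) := by
  intro R hR
  have h1 := outerRegion_subset₁ (swapChannel W) hr hr1 hη n₀ (mem_outerRegion_swap W hR)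
  have h2 := map_mem_closure (t := achievableBy W
    (fun M₁ M₂ => VLCode.det '' concatCodes₂ W (regionMAC W) η n₀ M₁ M₂) r 1)
    continuous_swap h1 fun R' hR' => achievableBy_swap W (fun M₁ M₂ V hV => ?_) hR'
  · exact h2
  · refine swap_mem_concatCodes₂ W ?_
    obtain ⟨K, L, m, n, B, B', e, pad₁, pad₂, h1, h2, h3⟩ := hV
    exact ⟨K, L, m, n, B, B', e, pad₁, pad₂, h1, mem_regionMAC_swap (swapChannel W) h2, h3⟩

theorem outerRegion_subset_achievableRegion₁ {r : ℝ} (hr : 0 ≤ r) (hr1 : r ≤ 1) :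
    outerRegion W 1 r ⊆ closure (achievableRegion W 1 r) :=
  (outerRegion_subset₁ W hr hr1 one_pos 0).trans
    (closure_mono (achievableBy_mono W (fun _ _ => Set.image_subset_range _ _) le_rfl le_rfl))

theorem outerRegion_subset_achievableRegion₂ {r : ℝ} (hr : 0 ≤ r) (hr1 : r ≤ 1) :
    outerRegion W r 1 ⊆ closure (achievableRegion W r 1) :=
  (outerRegion_subset₂ W hr hr1 one_pos 0).trans
    (closure_mono (achievableBy_mono W (fun _ _ => Set.image_subset_range _ _) le_rfl le_rfl))

end Deterministic


/-! ## Concatenated codes at the corner points of a pentagon -/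

section Corner

variable {X₁ X₂ Y : Type*} [Fintype X₁] [Nonempty X₁] [Fintype X₂] [Nonempty X₂] [Fintype Y]
  [MeasurableSpace Y] [DiscreteMeasurableSpace Y] (W : X₁ → X₂ → PMF Y)

/-- With `β = log b`, this splits `b ^ t` as `b ^ k * b ^ j`, so that the product of the two message
sizes is exactly the prescribed `M₂`; rounded sizes would not achieve this. The first block carries
about `m d`, and `n` is chosen so that the second carries the rest near rate `C`. -/
theorem exists_block_split {C d δ η c κ β : ℝ} (hC : 0 < C) (hd : 0 ≤ d) (hdC : d ≤ C)
    (hδ : 0 < δ) (hδκ : 6 * δ ≤ κ * C) (hκ : κ ≤ 1) (hδη : 2 * δ ≤ η) (hcη : c ≤ η)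
    (hcd : d < C → c < C - d) (hβ : 0 < β) (n₁ : ℕ) :
    ∃ m₁ : ℕ, ∀ m ≥ m₁, ∀ t : ℕ, t * β ≤ m * (C - δ) → m * (C - c) ≤ t * β →
      ∃ k j n : ℕ, k + j = t ∧ (k = 0 ∨ k * β ≤ m * (d - δ)) ∧ m * (d - η) ≤ k * β ∧
        k * β ≤ m * d ∧ j * β ≤ n * (C - δ) ∧ n * (C - η) ≤ j * β ∧ (n = 0 ∨ n₁ ≤ n) ∧
        (n : ℝ) ≤ m * (1 - d / C + κ) := by
  have hκ0 : 0 < κ := by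
    by_contra! h
    linarith [mul_nonpos_of_nonpos_of_nonneg h hC.le]
  -- If `d = C`, the first block carries everything and the second is empty. Otherwise `c < C - d`
  -- leaves an amount for the second block that grows linearly in `m`.
  rcases hdC.eq_or_lt with rfl | hlt
  · refine ⟨0, fun m _ t h1 h2 => ⟨t, 0, 0, rfl, Or.inr h1, ?_, ?_, by simp, by simp, Or.inl rfl, ?_⟩⟩
    · exact (mul_le_mul_of_nonneg_left (by linarith) (Nat.cast_nonneg m)).trans h2
    · exact h1.trans (mul_le_mul_of_nonneg_left (by linarith) (Nat.cast_nonneg m))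
    · rw [div_self hC.ne', sub_self, zero_add, Nat.cast_zero]
      positivity
  have hc := hcd hlt
  have hc' : 0 < C - d - c := by linarith
  -- Besides `n ≥ n₁`, this ensures `C ≤ n δ`, which absorbs the rounding up of `n`.
  set n₂ : ℕ := max n₁ ⌈C / δ⌉₊ with hn₂
  obtain ⟨m₁, hm₁⟩ := eventually_atTop.1 ((eventually_le_natCast_mul β hδ).and
    ((eventually_le_natCast_mul (n₂ * C) hc').and
      (eventually_le_natCast_mul (β + C) (show 0 < 4 * δ by linarith))))
  refine ⟨m₁, fun m hm t h1 h2 => ?_⟩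
  obtain ⟨g1, g2, g3⟩ := hm₁ m hm
  have hm0 : (0 : ℝ) ≤ m := Nat.cast_nonneg m
  have hδC : δ < C := by
    have := mul_le_mul_of_nonneg_right hκ hC.le
    linarith
  set x := max (d - δ) 0 with hx
  have hx0 : 0 ≤ x := le_max_right _ _
  have hxd : x ≤ d := max_le (by linarith) hd
  have hxd' : d - δ ≤ x := le_max_left _ _
  obtain ⟨k, hk⟩ : ∃ k, k = ⌊m * x / β⌋₊ := ⟨_, rfl⟩
  have hk1 : k * β ≤ m * x := by
    rw [← le_div_iff₀ hβ, hk]; exact Nat.floor_le (by positivity)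
  have hk2 : m * x ≤ (k + 1) * β := by
    rw [← div_le_iff₀ hβ, hk]; exact (Nat.lt_floor_add_one _).le
  have hmx : m * x ≤ m * d := mul_le_mul_of_nonneg_left hxd hm0
  have hmx' : m * (d - δ) ≤ m * x := mul_le_mul_of_nonneg_left hxd' hm0
  have hmη : m * (2 * δ) ≤ m * η := mul_le_mul_of_nonneg_left hδη hm0
  have hkt : k ≤ t := by
    have : (k : ℝ) * β ≤ t * β := by
      have := mul_le_mul_of_nonneg_left hc'.le hm0
      linarith
    exact_mod_cast le_of_mul_le_mul_right this hβ
  obtain ⟨j, rfl⟩ := Nat.exists_eq_add_of_le hkt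
  rw [Nat.cast_add] at h1 h2
  obtain ⟨n, hn⟩ : ∃ n, n = ⌈j * β / (C - δ)⌉₊ := ⟨_, rfl⟩
  have hCδ : 0 < C - δ := by linarith
  have hn1 : j * β ≤ n * (C - δ) := by
    rw [← div_le_iff₀ hCδ, hn]; exact Nat.le_ceil _
  have hn2 : n * (C - δ) ≤ j * β + (C - δ) := by
    have : (n : ℝ) < j * β / (C - δ) + 1 := by rw [hn]; exact Nat.ceil_lt_add_one (by positivity)
    have := mul_lt_mul_of_pos_right this hCδ
    rw [add_mul, div_mul_cancel₀ _ hCδ.ne'] at this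
    linarith
  have hn0 : (0 : ℝ) ≤ n := Nat.cast_nonneg n
  have hnδ : 0 ≤ n * δ := by positivity
  have hn3 : n₂ ≤ n := by
    have : (n₂ : ℝ) * C ≤ n * C := by linarith
    exact_mod_cast le_of_mul_le_mul_right this hC
  have hn4 : C ≤ n * δ := by
    rw [← div_le_iff₀ hδ]
    exact (Nat.le_ceil _).trans (by exact_mod_cast (le_max_right _ _).trans hn3)
  refine ⟨k, j, n, rfl, ?_, by linarith, by linarith, hn1, ?_,
    Or.inr ((le_max_left _ _).trans hn3), ?_⟩
  · rcases le_total (d - δ) 0 with h | h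
    · left
      rw [hk, hx, max_eq_right h]
      simp
    · right
      rwa [hx, max_eq_left h] at hk1
  · have : n * (2 * δ) ≤ n * η := mul_le_mul_of_nonneg_left hδη hn0
    linarith
  · refine le_of_mul_le_mul_right (a := C - δ) ?_ hCδ
    have hv : d / C * C = d := div_mul_cancel₀ _ hC.ne'
    have hv0 : 0 ≤ d / C := div_nonneg hd hC.le
    have e1 : (1 - d / C + κ) * (C - δ) = C - d + κ * C - δ * (1 - d / C + κ) := by
      linear_combination (-1 : ℝ) * hv
    have e2 : δ * (1 - d / C + κ) ≤ δ * 2 := mul_le_mul_of_nonneg_left (by linarith) hδ.le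
    -- Of the margin `6 δ ≤ κ C`, backing off to `C - δ` uses at most `2 δ`; the other `4 δ` per
    -- letter cover the rounding of `k` and `n`, at most `β + C` in all.
    have e3 : m * (C - d + 4 * δ) ≤ m * ((1 - d / C + κ) * (C - δ)) :=
      mul_le_mul_of_nonneg_left (by linarith) hm0
    linarith

theorem cast_sub_one_le_exp {M : ℕ} {x : ℝ} (hM : 0 < M) (h : Real.log M ≤ x) :
    (M : ℝ) - 1 ≤ Real.exp x := by
  have := (Real.log_le_iff_le_exp (by exact_mod_cast hM)).1 h
  linarith

/-- The corner `(C₁, d₂)` lies in `R_MAC`, so a single input distribution has `I₁ ≥ C₁`, `I₂ ≥ d₂`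
and `I₁₂ ≥ C₁ + d₂`; the block code is taken `δ` below it in each coordinate (with one message for
user 2 if that is negative). -/
theorem exists_corner_code₁ {d₁ d₂ δ η c κ ε : ℝ} (hC₂ : 0 < cap₂ W)
    (hpent : IsPentagon W d₁ d₂) (hε : 0 < ε) (hδ : 0 < δ) (hδκ : 6 * δ ≤ κ * cap₂ W)
    (hκ : κ ≤ 1) (hδη : 2 * δ ≤ η) (hcη : c ≤ η) (hcd : d₂ < cap₂ W → c < cap₂ W - d₂)
    (n₀ : ℕ) {b : ℕ} (hb : 2 ≤ b) :
    ∃ m₁ : ℕ, ∀ m ≥ m₁, ∀ M₁ t : ℕ, 0 < M₁ → Real.log M₁ ≤ m * (cap₁ W - δ) →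
      m * (cap₁ W - c) ≤ Real.log M₁ → t * Real.log b ≤ m * (cap₂ W - δ) →
      m * (cap₂ W - c) ≤ t * Real.log b →
      ∃ n : ℕ, ∃ V ∈ concatCodes₁ W {R ∈ regionMAC W | cap₁ W - η ≤ R.1 ∧ d₂ - η ≤ R.2} η n₀
        M₁ (b ^ t), V.N₁ = (fun _ => (m : ℕ∞)) ∧ V.N₂ = (fun _ => ((m + n : ℕ) : ℕ∞)) ∧
        (n : ℝ) ≤ m * (1 - d₂ / cap₂ W + κ) ∧ V.errorProb W < ε := by
  obtain ⟨hd₁, hd₁', hd₂, hd₂', hsum, hreg⟩ := hpent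
  have hC₁ : 0 ≤ cap₁ W := hd₁.trans hd₁'
  have hcorner : (cap₁ W, d₂) ∈ regionMAC W := by
    rw [hreg]; exact ⟨hC₁, le_rfl, hd₂, hd₂', le_rfl⟩
  obtain ⟨-, -, p, hp1, hp2, hp3⟩ := hcorner
  dsimp only at hp1 hp2 hp3
  have hβ : 0 < Real.log b := Real.log_pos (by exact_mod_cast hb)
  obtain ⟨n₁, hn₁⟩ := exists_mem_concatCodes₁ W p hδ hε
  obtain ⟨m₁, hm₁⟩ := exists_block_split hC₂ hd₂ hd₂' hδ hδκ hκ hδη hcη hcd hβ n₁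
  refine ⟨max m₁ (max n₁ (n₀ + 1)), fun m hm M₁ t hM₁ h1 h2 h3 h4 => ?_⟩
  have hm' : m₁ ≤ m ∧ n₁ ≤ m ∧ n₀ + 1 ≤ m := by simpa using hm
  obtain ⟨k, j, n, hkj, a1, a2, a3, a4, a5, a6, a7⟩ := hm₁ m hm'.1 t h3 h4
  have hm0 : (0 : ℝ) < m := by exact_mod_cast (show 0 < m by omega)
  have hb0 : 0 < b := by omega
  have hlog : ∀ i : ℕ, Real.log ((b ^ i : ℕ) : ℝ) = i * Real.log b := fun i => by
    rw [Nat.cast_pow, Real.log_pow]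
  have hmono : ∀ x y : ℝ, x ≤ y → m * (x - δ) ≤ m * (y - δ) := fun x y h =>
    mul_le_mul_of_nonneg_left (by linarith) hm0.le
  have hmδ : 0 ≤ m * δ := by positivity
  have hnδ : 0 ≤ n * δ := by positivity
  have hkpos : 0 < b ^ k := Nat.pow_pos hb0
  have hjpos : 0 < b ^ j := Nat.pow_pos hb0
  have hex := hn₁ m hm'.2.1 n a6 M₁ (b ^ k) (b ^ j) hM₁ hkpos hjpos
    (cast_sub_one_le_exp hM₁ (h1.trans (hmono _ _ hp1)))
    (by
      rcases a1 with rfl | a1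
      · simpa using (Real.exp_pos _).le
      · exact cast_sub_one_le_exp hkpos ((hlog k).trans_le (a1.trans (hmono _ _ hp2))))
    (by
      rcases a1 with rfl | a1
      · simpa using (Real.exp_pos _).le
      · have g1 := cast_sub_one_le_exp hM₁ h1
        have g2 := cast_sub_one_le_exp hkpos ((hlog k).trans_le a1)
        have g3 : (0 : ℝ) ≤ ((b ^ k : ℕ) : ℝ) - 1 := by
          have : (1 : ℝ) ≤ ((b ^ k : ℕ) : ℝ) := by exact_mod_cast hkpos
          linarith
        refine (mul_le_mul g1 g2 g3 (Real.exp_pos _).le).trans ?_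
        rw [← Real.exp_add]
        refine Real.exp_le_exp.2 ?_
        have := hmono _ _ hp3
        linarith)
    (cast_sub_one_le_exp hjpos ((hlog j).trans_le a4)) η n₀ hm'.2.2
    (T := {R ∈ regionMAC W | cap₁ W - η ≤ R.1 ∧ d₂ - η ≤ R.2})
    (by
      rw [hlog]
      have f1 : Real.log M₁ / m ≤ cap₁ W := by rw [div_le_iff₀' hm0]; linarith
      have f2 : k * Real.log b / m ≤ d₂ := by rw [div_le_iff₀' hm0]; linarith
      have f3 : cap₁ W - η ≤ Real.log M₁ / m := by
        rw [le_div_iff₀' hm0]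
        exact (mul_le_mul_of_nonneg_left (by linarith) hm0.le).trans h2
      have f4 : d₂ - η ≤ k * Real.log b / m := by rw [le_div_iff₀' hm0]; linarith
      refine ⟨?_, f3, f4⟩
      rw [hreg]
      exact ⟨div_nonneg (Real.log_natCast_nonneg _) hm0.le, f1, by positivity,
        f2.trans hd₂', add_le_add f1 f2⟩)
    (by rw [hlog]; exact a5) (by rw [hlog]; linarith)
  rw [← pow_add, hkj] at hex
  obtain ⟨V, hV, hN₁, hN₂, herr⟩ := hex
  exact ⟨n, V, hV, hN₁, hN₂, a7, herr⟩

theorem exists_corner_code₂ {d₁ d₂ δ η c κ ε : ℝ} (hC₁ : 0 < cap₁ W)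
    (hpent : IsPentagon W d₁ d₂) (hε : 0 < ε) (hδ : 0 < δ) (hδκ : 6 * δ ≤ κ * cap₁ W)
    (hκ : κ ≤ 1) (hδη : 2 * δ ≤ η) (hcη : c ≤ η) (hcd : d₁ < cap₁ W → c < cap₁ W - d₁)
    (n₀ : ℕ) {a : ℕ} (ha : 2 ≤ a) :
    ∃ m₁ : ℕ, ∀ m ≥ m₁, ∀ M₂ s : ℕ, 0 < M₂ → Real.log M₂ ≤ m * (cap₂ W - δ) →
      m * (cap₂ W - c) ≤ Real.log M₂ → s * Real.log a ≤ m * (cap₁ W - δ) →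
      m * (cap₁ W - c) ≤ s * Real.log a →
      ∃ n : ℕ, ∃ V ∈ concatCodes₂ W {R ∈ regionMAC W | d₁ - η ≤ R.1 ∧ cap₂ W - η ≤ R.2} η n₀
        (a ^ s) M₂, V.N₁ = (fun _ => ((m + n : ℕ) : ℕ∞)) ∧ V.N₂ = (fun _ => (m : ℕ∞)) ∧
        (n : ℝ) ≤ m * (1 - d₁ / cap₁ W + κ) ∧ V.errorProb W < ε := by
  have h := exists_corner_code₁ (swapChannel W) (d₁ := d₂) (d₂ := d₁) (δ := δ) (η := η) (c := c)
    (κ := κ) (ε := ε) (by rwa [cap₂_swap]) hpent.swap hε hδ (by rwa [cap₂_swap]) hκ hδη hcη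
    (by rwa [cap₂_swap]) n₀ ha
  rw [cap₁_swap, cap₂_swap] at h
  obtain ⟨m₁, hm₁⟩ := h
  refine ⟨m₁, fun m hm M₂ s hM₂ h1 h2 h3 h4 => ?_⟩
  obtain ⟨n, V, hV, hN₁, hN₂, hn, herr⟩ := hm₁ m hm M₂ s hM₂ h1 h2 h3 h4
  refine ⟨n, V.swap, swap_mem_concatCodes₂ W ?_, hN₂, hN₁, hn, ?_⟩
  · obtain ⟨K, L, m, n, B, B', e, pad₁, pad₂, g1, ⟨g2, g3, g4⟩, g5⟩ := hV
    exact ⟨K, L, m, n, B, B', e, pad₁, pad₂, g1,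
      ⟨mem_regionMAC_swap (swapChannel W) g2, g4, g3⟩, g5⟩
  · rwa [← VLCode.errorProb_swap] at herr

/-! ## Alternation -/

/-- The common first length makes `min N₁ N₂` equal to `m` for both codes; randomization affects
only how often each user waits for a second block. -/
theorem alternate_means {M₁ M₂ m n n' : ℕ} {V V' : VLCode X₁ X₂ Y M₁ M₂} (t : I)
    (hM₁ : 0 < M₁) (hM₂ : 0 < M₂)
    (hN₁ : V.N₁ = fun _ => (m : ℕ∞)) (hN₂ : V.N₂ = fun _ => ((m + n : ℕ) : ℕ∞))
    (hN₁' : V'.N₁ = fun _ => ((m + n' : ℕ) : ℕ∞)) (hN₂' : V'.N₂ = fun _ => (m : ℕ∞)) :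
    (VLCode.alternate t V V').meanN₁ W = ENNReal.ofReal (m + (1 - t) * n') ∧
    (VLCode.alternate t V V').meanN₂ W = ENNReal.ofReal (m + t * n) ∧
    (VLCode.alternate t V V').meanN W = ENNReal.ofReal m ∧
    (VLCode.alternate t V V').errorProb W =
      t * V.errorProb W + (1 - t) * V'.errorProb W := by
  have key : ∀ x y : ℝ≥0∞, ∀ a b : ℝ, 0 ≤ a → 0 ≤ b → x = ENNReal.ofReal a → y = ENNReal.ofReal b →
      (unitInterval.toNNReal t : ℝ≥0∞) * x +
        (unitInterval.toNNReal (unitInterval.symm t) : ℝ≥0∞) * y =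
      ENNReal.ofReal (t * a + (1 - t) * b) := by
    rintro x y a b ha hb rfl rfl
    have h1 : ∀ s : I, (unitInterval.toNNReal s : ℝ≥0∞) = ENNReal.ofReal (s : ℝ) := by
      intro s
      rw [ENNReal.ofReal, ENNReal.coe_inj]
      exact (Real.toNNReal_of_nonneg s.2.1).symm
    have h2 : (0 : ℝ) ≤ 1 - t := by linarith [t.2.2]
    rw [h1, h1, ← ENNReal.ofReal_mul t.2.1, ← ENNReal.ofReal_mul (unitInterval.symm t).2.1,
      ← ENNReal.ofReal_add (mul_nonneg t.2.1 ha) (mul_nonneg (unitInterval.symm t).2.1 hb)]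
    rfl
  have hc : ∀ k : ℕ, ((k : ℕ) : ℝ≥0∞) = ENNReal.ofReal (k : ℝ) := fun k =>
    (ENNReal.ofReal_natCast k).symm
  refine ⟨?_, ?_, ?_, ?_⟩
  · have h : (VLCode.alternate t V V').meanN₁ W = (unitInterval.toNNReal t : ℝ≥0∞) * V.mean W V.N₁ +
        (unitInterval.toNNReal (unitInterval.symm t) : ℝ≥0∞) * V'.mean W V'.N₁ :=
      Fin.sum_univ_two _
    rw [h, hN₁, hN₁', VLCode.mean_const V W hM₁ hM₂, VLCode.mean_const V' W hM₁ hM₂,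
      key _ _ _ _ (Nat.cast_nonneg _) (Nat.cast_nonneg _) (hc _) (hc _)]
    congr 1; push_cast; ring
  · have h : (VLCode.alternate t V V').meanN₂ W = (unitInterval.toNNReal t : ℝ≥0∞) * V.mean W V.N₂ +
        (unitInterval.toNNReal (unitInterval.symm t) : ℝ≥0∞) * V'.mean W V'.N₂ :=
      Fin.sum_univ_two _
    rw [h, hN₂, hN₂', VLCode.mean_const V W hM₁ hM₂, VLCode.mean_const V' W hM₁ hM₂,
      key _ _ _ _ (Nat.cast_nonneg _) (Nat.cast_nonneg _) (hc _) (hc _)]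
    congr 1; push_cast; ring
  · have h : (VLCode.alternate t V V').meanN W =
        (unitInterval.toNNReal t : ℝ≥0∞) * V.mean W (fun y => min (V.N₁ y) (V.N₂ y)) +
        (unitInterval.toNNReal (unitInterval.symm t) : ℝ≥0∞) *
          V'.mean W (fun y => min (V'.N₁ y) (V'.N₂ y)) :=
      Fin.sum_univ_two _
    rw [h, hN₁, hN₁', hN₂, hN₂']
    simp only [min_comm ((m + n' : ℕ) : ℕ∞), min_natCast_add]
    rw [VLCode.mean_const V W hM₁ hM₂, VLCode.mean_const V' W hM₁ hM₂,
      key _ _ _ _ (Nat.cast_nonneg _) (Nat.cast_nonneg _) (hc _) (hc _)]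
    congr 1; ring
  · exact Fin.sum_univ_two _

end Corner

/-! ## Message sets with matching logarithms -/

/-- Commensurable logarithms allow equal exponents and tolerance `0`. Otherwise powers of `2` are
used, and Dirichlet's theorem approximates `C₂ / C₁` by `j / k`. -/
theorem exists_matching_powers {C₁ C₂ τ : ℝ} (hC₁ : 0 < C₁) (hC₂ : 0 < C₂) (hτ : 0 ≤ τ)
    (h : 0 < τ ∨ ∃ a b : ℕ, 2 ≤ a ∧ 2 ≤ b ∧ Real.log a / C₁ = Real.log b / C₂) :
    ∃ a b : ℕ, 2 ≤ a ∧ 2 ≤ b ∧ ∀ T : ℝ, ∃ s t : ℕ, T ≤ s * Real.log a / C₁ ∧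
      |s * Real.log a / C₁ - t * Real.log b / C₂| ≤ τ := by
  have hlog : ∀ a : ℕ, 2 ≤ a → 0 < Real.log a := fun a ha =>
    Real.log_pos (by exact_mod_cast ha)
  rcases h with hτ | ⟨a, b, ha, hb, hab⟩
  swap
  · refine ⟨a, b, ha, hb, fun T => ?_⟩
    obtain ⟨s, hs⟩ := (eventually_le_natCast_mul T (div_pos (hlog a ha) hC₁)).exists
    refine ⟨s, s, by rwa [mul_div_assoc], ?_⟩
    rw [mul_div_assoc, mul_div_assoc, hab, sub_self, abs_zero]
    exact hτ
  refine ⟨2, 2, le_rfl, le_rfl, fun T => ?_⟩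
  have hl := hlog 2 le_rfl
  obtain ⟨S, hS⟩ := (eventually_le_natCast_mul T (div_pos hl hC₁)).exists
  set γ := Real.log (2 : ℕ) / C₂ with hγ
  have hγ0 : 0 < γ := div_pos hl hC₂
  -- The exponents `S k` and `S j` are large because of `S`, which also multiplies the error; the
  -- Dirichlet bound `1 / (n + 1)` must therefore beat `S γ / τ`.
  obtain ⟨n, hn⟩ := ((eventually_le_natCast_mul (S * γ) hτ).and (eventually_gt_atTop 0)).exists
  obtain ⟨k, hk0, hkn, hk⟩ := Real.exists_nat_abs_mul_sub_round_le (C₂ / C₁) hn.2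
  have hr : 0 ≤ round ((k : ℝ) * (C₂ / C₁)) := by
    rw [round_eq]
    exact Int.floor_nonneg.2 (by positivity)
  obtain ⟨j, hj⟩ := Int.eq_ofNat_of_zero_le hr
  rw [hj] at hk
  refine ⟨S * k, S * j, ?_, ?_⟩
  · rw [mul_div_assoc]
    refine hS.trans (mul_le_mul_of_nonneg_right ?_ (div_pos hl hC₁).le)
    exact_mod_cast Nat.le_mul_of_pos_right S hk0
  · have e : ((S * k : ℕ) : ℝ) * Real.log (2 : ℕ) / C₁ - ((S * j : ℕ) : ℝ) * Real.log (2 : ℕ) / C₂ =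
        (S * γ) * (k * (C₂ / C₁) - ((j : ℤ) : ℝ)) := by
      rw [hγ]
      push_cast
      field_simp
    rw [e, abs_mul, abs_of_nonneg (by positivity)]
    refine (mul_le_mul_of_nonneg_left hk (by positivity)).trans ?_
    rw [mul_one_div, div_le_iff₀ (by positivity)]
    linarith [hn.1]

/-! ## The pentagon case -/

/-- Here `T₁` and `T₂` stand for `log Mᵢ / Cᵢ`. Taking `m` slightly above `(1 + μ) max T₁ T₂` puts
both rates just below capacity, since the discrepancy `τ` is negligible against `μ T₁` and `μ T₂`.
-/
theorem exists_block_length {μ τ T₁ T₂ : ℝ} (hμ : 0 < μ) (hμ1 : μ ≤ 1)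
    (hτ : |T₁ - T₂| ≤ τ) (hT : 2 * τ + 1 ≤ μ * T₁) (hT' : 2 * τ + 1 ≤ μ * T₂) :
    ∃ m : ℕ, T₁ ≤ m * (1 - μ / 2) ∧ T₂ ≤ m * (1 - μ / 2) ∧ m ≤ T₁ * (1 + 2 * μ) ∧
      m ≤ T₂ * (1 + 2 * μ) := by
  have hτ0 : 0 ≤ τ := (abs_nonneg _).trans hτ
  obtain ⟨h1, h2⟩ := abs_le.1 hτ
  have hT₁ : 0 < T₁ := by
    by_contra! h
    linarith [mul_nonpos_of_nonneg_of_nonpos hμ.le h]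
  have hT₂ : 0 < T₂ := by
    by_contra! h
    linarith [mul_nonpos_of_nonneg_of_nonpos hμ.le h]
  set T := max T₁ T₂ with hTdef
  have hT0 : 0 < T := lt_max_of_lt_left hT₁
  refine ⟨⌈T * (1 + μ)⌉₊, ?_, ?_, ?_, ?_⟩
  all_goals
    have hm := Nat.le_ceil (T * (1 + μ))
    have hm' := (Nat.ceil_lt_add_one (show 0 ≤ T * (1 + μ) by positivity)).le
    have e1 := mul_le_mul_of_nonneg_right hm (show 0 ≤ 1 - μ / 2 by linarith)
    have e2 : T ≤ T * (1 + μ) * (1 - μ / 2) := by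
      have : 1 ≤ (1 + μ) * (1 - μ / 2) := by nlinarith
      calc T = T * 1 := (mul_one T).symm
        _ ≤ T * ((1 + μ) * (1 - μ / 2)) := mul_le_mul_of_nonneg_left this hT0.le
        _ = _ := by ring
    have e3 : T ≤ T₁ + τ := max_le (by linarith) (by linarith)
    have e4 : T ≤ T₂ + τ := max_le (by linarith) (by linarith)
    have e5 := mul_le_mul_of_nonneg_right e3 (show 0 ≤ 1 + μ by linarith)
    have e6 := mul_le_mul_of_nonneg_right e4 (show 0 ≤ 1 + μ by linarith)
    have e7 := mul_le_mul_of_nonneg_left hμ1 hτ0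
  · exact (le_max_left _ _).trans (e2.trans e1)
  · exact (le_max_right _ _).trans (e2.trans e1)
  · linarith
  · linarith

/-- One factor `1 + κ` pays for the excess length, since `1 + x + κ ≤ (1 + x)(1 + κ)`, the other for
a first-block rate below `C`. -/
theorem rate_le_of_length_le {R C x κ m E l : ℝ} (hR : 0 ≤ R) (hC : 0 < C) (hx : 0 ≤ x)
    (hκ : 0 < κ) (hm : 0 < m) (hE : 0 < E) (hRC : R ≤ C / (1 + x)) (hEm : E ≤ m * (1 + x + κ))
    (hl : m * C ≤ (1 + κ) * l) : R / (1 + κ) ^ 2 / C ≤ m / E ∧ R / (1 + κ) ^ 2 ≤ l / E := by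
  rw [le_div_iff₀ (by positivity)] at hRC
  have h1 : R * E ≤ m * (1 + κ) * C := by
    calc R * E ≤ R * (m * (1 + x + κ)) := mul_le_mul_of_nonneg_left hEm hR
      _ ≤ R * (m * ((1 + x) * (1 + κ))) := by
        refine mul_le_mul_of_nonneg_left (mul_le_mul_of_nonneg_left ?_ hm.le) hR
        linarith [mul_nonneg hx hκ.le]
      _ = R * (1 + x) * (m * (1 + κ)) := by ring
      _ ≤ C * (m * (1 + κ)) := mul_le_mul_of_nonneg_right hRC (by positivity)
      _ = _ := by ring
  constructor
  · rw [div_div, div_le_div_iff₀ (by positivity) hE]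
    have : 0 ≤ m * C * κ * (1 + κ) := by positivity
    linarith
  · rw [div_le_div_iff₀ (by positivity) hE]
    have := mul_le_mul_of_nonneg_left hl (show 0 ≤ 1 + κ by linarith)
    linarith

/-- The function `q ↦ C / (1 + q u)` is strictly convex and decreasing, so the mean of its values at
`0` and `1` exceeds its value at `1/2`. -/
theorem lt_half_of_midpoint_le {C u q : ℝ} (hC : 0 < C) (hu : 0 < u) (hq : 0 ≤ q)
    (h : 1 / 2 * (C / (1 + u)) + 1 / 2 * C ≤ C / (1 + q * u)) : q < 1 / 2 := by
  rw [le_div_iff₀ (by positivity)] at h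
  have h1 : C / (1 + u) * (1 + u) = C := div_mul_cancel₀ _ (by positivity)
  have h2 : C * ((2 + u) * (1 + q * u)) ≤ C * (2 * (1 + u)) := by
    have := mul_le_mul_of_nonneg_right h (show 0 ≤ 2 * (1 + u) by positivity)
    calc C * ((2 + u) * (1 + q * u)) =
        (1 / 2 * (C / (1 + u)) + 1 / 2 * C) * (1 + q * u) * (2 * (1 + u)) := by
          linear_combination (-(1 + q * u)) * h1
      _ ≤ _ := this
  have h3 := le_of_mul_le_mul_left h2 hC
  have h4 : u * (q * (2 + u)) ≤ u * 1 := by linarith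
  have h5 := le_of_mul_le_mul_left h4 hu
  by_contra! h6
  have := mul_le_mul_of_nonneg_right h6 (show 0 ≤ 2 + u by linarith)
  linarith

section Pentagon

variable {X₁ X₂ Y : Type*} [Fintype X₁] [Nonempty X₁] [Fintype X₂] [Nonempty X₂] [Fintype Y]
  [MeasurableSpace Y] [DiscreteMeasurableSpace Y] (W : X₁ → X₂ → PMF Y)

/-- The midpoint of the extreme points for `p = 0` and `p = 1` would need both `p` and `1 - p` below
`1/2`. -/
theorem not_convex_pentagonOuterRegion {d₁ d₂ : ℝ} (hC₁ : 0 < cap₁ W) (hC₂ : 0 < cap₂ W)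
    (hpent : IsPentagon W d₁ d₂) (hd : d₁ < cap₁ W) :
    ¬ Convex ℝ (pentagonOuterRegion W d₁ d₂) := by
  obtain ⟨hd₁, -, hd₂, -, hsum, -⟩ := hpent
  intro hconv
  set u := 1 - d₁ / cap₁ W with hu
  set v := 1 - d₂ / cap₂ W with hv
  have hu0 : 0 < u := by rw [hu, sub_pos, div_lt_one hC₁]; exact hd
  have hv0 : 0 < v := by rw [hv, sub_pos, div_lt_one hC₂]; linarith
  have hA : (cap₁ W / (1 + u), cap₂ W) ∈ pentagonOuterRegion W d₁ d₂ :=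
    ⟨by positivity, hC₂.le, 0, ⟨le_rfl, zero_le_one⟩, by simp [← hu], by simp⟩
  have hB : (cap₁ W, cap₂ W / (1 + v)) ∈ pentagonOuterRegion W d₁ d₂ :=
    ⟨hC₁.le, by positivity, 1, ⟨zero_le_one, le_rfl⟩, by simp, by simp [← hv]⟩
  obtain ⟨-, -, p, ⟨hp0, hp1⟩, h1, h2⟩ := hconv hA hB (a := 1 / 2) (b := 1 / 2) (by norm_num)
    (by norm_num) (by norm_num)
  simp only [Prod.fst_add, Prod.snd_add, Prod.smul_fst, Prod.smul_snd, smul_eq_mul] at h1 h2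
  have g1 := lt_half_of_midpoint_le hC₁ hu0 (sub_nonneg.2 hp1) h1
  have g2 := lt_half_of_midpoint_le hC₂ hv0 hp0 (by rw [add_comm]; exact h2)
  linarith

theorem scaled_mem_achievableBy {d₁ d₂ η τ κ : ℝ} (hC₁ : 0 < cap₁ W) (hC₂ : 0 < cap₂ W)
    (hpent : IsPentagon W d₁ d₂) (hη : 0 < η) (hτ : 0 ≤ τ) (n₀ : ℕ)
    (hpow : 0 < τ ∨ ∃ a b : ℕ, 2 ≤ a ∧ 2 ≤ b ∧ Real.log a / cap₁ W = Real.log b / cap₂ W)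
    (hκ : 0 < κ) (hκ1 : κ ≤ 1) {R : ℝ × ℝ} (hR : R ∈ pentagonOuterRegion W d₁ d₂) :
    (R.1 / (1 + κ) ^ 2, R.2 / (1 + κ) ^ 2) ∈ achievableBy W (alternatingCodes W d₁ d₂ η τ n₀)
      (R.1 / (1 + κ) ^ 2 / cap₁ W) (R.2 / (1 + κ) ^ 2 / cap₂ W) := by
  intro ε hε
  obtain ⟨hR₁, hR₂, p, hp, hb₁, hb₂⟩ := hR
  obtain ⟨a, b, ha, hb, hab⟩ := exists_matching_powers hC₁ hC₂ hτ hpow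
  obtain ⟨hd₁, hd₁', hd₂, hd₂', hsum, -⟩ := id hpent
  set C₁ := cap₁ W with hC₁def
  set C₂ := cap₂ W with hC₂def
  set g : ℝ := if d₁ < C₁ then C₁ - d₁ else 1 with hg
  have hg0 : 0 < g := by
    rw [hg]; split_ifs with h
    · linarith
    · exact one_pos
  set M := max C₁ C₂ with hM
  have hM0 : 0 < M := lt_max_of_lt_left hC₁
  have hM₁ : C₁ ≤ M := le_max_left _ _
  have hM₂ : C₂ ≤ M := le_max_right _ _
  obtain ⟨μ, hμ, hμ1, hμκ, hμη, hμg⟩ : ∃ μ : ℝ, 0 < μ ∧ μ ≤ 1 ∧ 3 * μ ≤ κ ∧ 2 * μ * M ≤ η ∧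
      2 * μ * M < g := by
    refine ⟨min (κ / 3) (min (η / (2 * M)) (g / (4 * M))), by positivity, ?_, ?_, ?_, ?_⟩
    · exact (min_le_left _ _).trans (by linarith)
    · linarith [min_le_left (κ / 3) (min (η / (2 * M)) (g / (4 * M)))]
    · have h := (min_le_right (κ / 3) _).trans (min_le_left (η / (2 * M)) (g / (4 * M)))
      rw [le_div_iff₀ (by positivity)] at h
      linarith
    · have h := (min_le_right (κ / 3) _).trans (min_le_right (η / (2 * M)) (g / (4 * M)))
      rw [le_div_iff₀ (by positivity)] at h
      linarith
  -- Since `6 δ ≤ 3 μ Cᵢ ≤ κ Cᵢ`, this meets the demands of the corner codes for both users.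
  set δ := μ / 2 * min C₁ C₂ with hδ
  have hδ0 : 0 < δ := by positivity
  have hδ₁ : δ ≤ μ / 2 * C₁ := mul_le_mul_of_nonneg_left (min_le_left _ _) (by positivity)
  have hδ₂ : δ ≤ μ / 2 * C₂ := mul_le_mul_of_nonneg_left (min_le_right _ _) (by positivity)
  have hδη : 2 * δ ≤ η := by
    have := mul_le_mul_of_nonneg_left hM₁ hμ.le
    have := mul_pos hμ hM0
    linarith
  have hκ₁ := mul_le_mul_of_nonneg_right hμκ hC₁.le
  have hκ₂ := mul_le_mul_of_nonneg_right hμκ hC₂.le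
  have hgap₁ : d₁ < C₁ → 2 * μ * M < C₁ - d₁ := fun h => by rwa [hg, if_pos h] at hμg
  have hgap₂ : d₂ < C₂ → 2 * μ * M < C₂ - d₂ := fun h => by
    have := hgap₁ (by linarith)
    linarith
  obtain ⟨m₁, hm₁⟩ := exists_corner_code₁ W hC₂ hpent hε hδ0 (by linarith) hκ1 hδη hμη hgap₂ n₀ hb
  obtain ⟨m₂, hm₂⟩ := exists_corner_code₂ W hC₁ hpent hε hδ0 (by linarith) hκ1 hδη hμη hgap₁ n₀ ha
  -- The message sets are fixed before the block length, large enough that the length derived from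
  -- them exceeds `m₁` and `m₂`; the added `τ` makes the bound hold for `T₂` as well.
  obtain ⟨s, t, hsT, hst⟩ := hab (max ((2 * τ + 1) / μ + τ) (max m₁ m₂))
  set T₁ := s * Real.log a / C₁ with hT₁
  set T₂ := t * Real.log b / C₂ with hT₂
  have hsT' := max_le_iff.1 hsT
  have hT₁' : (2 * τ + 1) / μ ≤ T₁ := by linarith [hsT'.1]
  have hT₂' : (2 * τ + 1) / μ ≤ T₂ := by linarith [hsT'.1, (abs_le.1 hst).2]
  have hm₁T := max_le_iff.1 hsT'.2
  obtain ⟨m, hmT₁, hmT₂, hm, hm'⟩ := exists_block_length hμ hμ1 hst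
    ((div_le_iff₀' hμ).1 hT₁') ((div_le_iff₀' hμ).1 hT₂')
  have hT₁0 : 0 < T₁ := lt_of_lt_of_le (by positivity) hT₁'
  have hT₂0 : 0 < T₂ := lt_of_lt_of_le (by positivity) hT₂'
  have hm0 : (0 : ℝ) < m := by
    by_contra! h
    have := mul_nonpos_of_nonpos_of_nonneg h (show 0 ≤ 1 - μ / 2 by linarith)
    linarith
  have hmT : T₁ ≤ m := hmT₁.trans (mul_le_of_le_one_right hm0.le (by linarith))
  have hmm₁ : m₁ ≤ m := by exact_mod_cast hm₁T.1.trans hmT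
  have hmm₂ : m₂ ≤ m := by exact_mod_cast hm₁T.2.trans hmT
  have hl₁ : s * Real.log a = T₁ * C₁ := (div_mul_cancel₀ _ hC₁.ne').symm
  have hl₂ : t * Real.log b = T₂ * C₂ := (div_mul_cancel₀ _ hC₂.ne').symm
  have hup : ∀ T C : ℝ, 0 < C → T ≤ m * (1 - μ / 2) → δ ≤ μ / 2 * C → T * C ≤ m * (C - δ) := by
    intro T C hC h1 h2
    have h3 := mul_le_mul_of_nonneg_right h1 hC.le
    have h4 := mul_le_mul_of_nonneg_left h2 hm0.le
    linarith
  have hlow : ∀ T C : ℝ, 0 < C → 0 < T → m ≤ T * (1 + 2 * μ) → C ≤ M →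
      m * (C - 2 * μ * M) ≤ T * C := by
    intro T C hC hT h1 h2
    have h3 : m * (C - 2 * μ * M) ≤ m * (C * (1 - 2 * μ)) := by
      refine mul_le_mul_of_nonneg_left ?_ hm0.le
      linarith [mul_le_mul_of_nonneg_left h2 hμ.le]
    have h4 := mul_le_mul_of_nonneg_right h1
      (mul_nonneg hC.le (show 0 ≤ 1 - 2 * μ by linarith))
    have h5 : 0 ≤ T * C * (4 * μ ^ 2) := by positivity
    linarith
  have hlog : ∀ c i : ℕ, Real.log ((c ^ i : ℕ) : ℝ) = i * Real.log c := fun c i => by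
    rw [Nat.cast_pow, Real.log_pow]
  have hMa : 0 < a ^ s := Nat.pow_pos (by omega)
  have hMb : 0 < b ^ t := Nat.pow_pos (by omega)
  have u₁ := hup T₁ C₁ hC₁ hmT₁ hδ₁
  have u₂ := hup T₂ C₂ hC₂ hmT₂ hδ₂
  have l₁ := hlow T₁ C₁ hC₁ hT₁0 hm hM₁
  have l₂ := hlow T₂ C₂ hC₂ hT₂0 hm' hM₂
  obtain ⟨n, V, hV, hN₁, hN₂, hn, herr⟩ := hm₁ m hmm₁ (a ^ s) t hMa
    (by rw [hlog, hl₁]; exact u₁) (by rw [hlog, hl₁]; exact l₁) (by rw [hl₂]; exact u₂)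
    (by rw [hl₂]; exact l₂)
  obtain ⟨n', V', hV', hN₁', hN₂', hn', herr'⟩ := hm₂ m hmm₂ (b ^ t) s hMb
    (by rw [hlog, hl₂]; exact u₂) (by rw [hlog, hl₂]; exact l₂) (by rw [hl₁]; exact u₁)
    (by rw [hl₁]; exact l₁)
  obtain ⟨e₁, e₂, e₃, e₄⟩ := alternate_means W ⟨p, hp⟩ hMa hMb hN₁ hN₂ hN₁' hN₂'
  dsimp only at e₁ e₂ e₄
  have hp0 : 0 ≤ p := hp.1
  have hp1 : 0 ≤ 1 - p := by linarith [hp.2]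
  have hE₁ : 0 < m + (1 - p) * n' := by positivity
  have hE₂ : 0 < m + p * n := by positivity
  have hx₁ : 0 ≤ (1 - p) * (1 - d₁ / C₁) :=
    mul_nonneg hp1 (sub_nonneg.2 ((div_le_one hC₁).2 hd₁'))
  have hx₂ : 0 ≤ p * (1 - d₂ / C₂) :=
    mul_nonneg hp0 (sub_nonneg.2 ((div_le_one hC₂).2 hd₂'))
  have hmκ : 0 ≤ m * κ := by positivity
  have hlen : ∀ T C : ℝ, 0 < T → 0 < C → m ≤ T * (1 + 2 * μ) → m * C ≤ (1 + κ) * (T * C) := by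
    intro T C hT hC h
    have h1 := mul_le_mul_of_nonneg_right h hC.le
    have h2 := mul_le_mul_of_nonneg_left (show 2 * μ ≤ κ by linarith) (mul_pos hT hC).le
    linarith
  have r₁ := rate_le_of_length_le hR₁ hC₁ hx₁ hκ hm0 hE₁ hb₁
    (by
      have h1 := mul_le_mul_of_nonneg_left hn' hp1
      have h2 := mul_nonneg hp0 hmκ
      linarith) (hlen T₁ C₁ hT₁0 hC₁ hm)
  have r₂ := rate_le_of_length_le hR₂ hC₂ hx₂ hκ hm0 hE₂ hb₂
    (by
      have h1 := mul_le_mul_of_nonneg_left hn hp0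
      have h2 := mul_nonneg hp1 hmκ
      linarith) (hlen T₂ C₂ hT₂0 hC₂ hm')
  refine ⟨a ^ s, b ^ t, VLCode.alternate ⟨p, hp⟩ V V', ⟨?_, V, hV, V', hV', ⟨p, hp⟩, rfl⟩, ?_⟩
  · rw [hlog, hlog]; exact hst
  rw [e₁, e₂, e₃, e₄, ENNReal.toReal_ofReal hE₁.le, ENNReal.toReal_ofReal hE₂.le,
    ENNReal.toReal_ofReal hm0.le, hlog, hlog, hl₁, hl₂]
  refine ⟨(ENNReal.ofReal_pos.2 hE₁).ne', ENNReal.ofReal_ne_top, (ENNReal.ofReal_pos.2 hE₂).ne',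
    ENNReal.ofReal_ne_top, r₁.1, r₂.1, r₁.2, r₂.2, ?_⟩
  have h1 := mul_le_mul_of_nonneg_left (le_max_left (V.errorProb W) (V'.errorProb W)) hp0
  have h2 := mul_le_mul_of_nonneg_left (le_max_right (V.errorProb W) (V'.errorProb W)) hp1
  have h3 := max_lt herr herr'
  linarith

theorem pentagonOuterRegion_subset {d₁ d₂ η τ : ℝ} (hC₁ : 0 < cap₁ W) (hC₂ : 0 < cap₂ W)
    (hpent : IsPentagon W d₁ d₂) (hη : 0 < η) (hτ : 0 ≤ τ) (n₀ : ℕ)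
    (hpow : 0 < τ ∨ ∃ a b : ℕ, 2 ≤ a ∧ 2 ≤ b ∧ Real.log a / cap₁ W = Real.log b / cap₂ W) :
    pentagonOuterRegion W d₁ d₂ ⊆ closure {R | R ∈ achievableBy W
      (alternatingCodes W d₁ d₂ η τ n₀) (R.1 / cap₁ W) (R.2 / cap₂ W)} := by
  intro R hR
  have hc : Tendsto (fun κ : ℝ => (R.1 / (1 + κ) ^ 2, R.2 / (1 + κ) ^ 2)) (𝓝[>] 0) (𝓝 R) := by
    have : ContinuousAt (fun κ : ℝ => (R.1 / (1 + κ) ^ 2, R.2 / (1 + κ) ^ 2)) 0 := by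
      refine ContinuousAt.prodMk ?_ ?_ <;>
        exact ContinuousAt.div (by fun_prop) (by fun_prop) (by norm_num)
    have := this.tendsto.mono_left (nhdsWithin_le_nhds (s := Set.Ioi 0))
    simpa using this
  refine mem_closure_of_tendsto hc ?_
  filter_upwards [Ioc_mem_nhdsGT (zero_lt_one' ℝ)] with κ hκ
  exact scaled_mem_achievableBy W hC₁ hC₂ hpent hη hτ n₀ hpow hκ.1 hκ.2 hR

end Pentagon

end

end MAC

theorem mainTheorem2 {X₁ X₂ Y : Type*} [Fintype X₁] [Nonempty X₁] [Fintype X₂] [Nonempty X₂]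
    [Fintype Y] [MeasurableSpace Y] [DiscreteMeasurableSpace Y] (W : X₁ → X₂ → PMF Y) :
    -- the case `E[N] = E[N₁]`
    (∀ r₂ ∈ Set.Icc (0 : ℝ) 1,
      (∀ η > 0, ∀ n₀ : ℕ, MAC.outerRegion W 1 r₂ ⊆
        closure (MAC.achievableBy W
          (fun M₁ M₂ => MAC.VLCode.det '' MAC.concatCodes₁ W (MAC.regionMAC W) η n₀ M₁ M₂) 1 r₂)) ∧
      MAC.outerRegion W 1 r₂ ⊆ closure (MAC.achievableRegion W 1 r₂)) ∧
    -- the case `E[N] = E[N₂]`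
    (∀ r₁ ∈ Set.Icc (0 : ℝ) 1,
      (∀ η > 0, ∀ n₀ : ℕ, MAC.outerRegion W r₁ 1 ⊆
        closure (MAC.achievableBy W
          (fun M₁ M₂ => MAC.VLCode.det '' MAC.concatCodes₂ W (MAC.regionMAC W) η n₀ M₁ M₂) r₁ 1)) ∧
      MAC.outerRegion W r₁ 1 ⊆ closure (MAC.achievableRegion W r₁ 1)) ∧
    -- the pentagon case, by random alternation
    (∀ d₁ d₂ : ℝ, 0 < MAC.cap₁ W → 0 < MAC.cap₂ W → MAC.IsPentagon W d₁ d₂ →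
      (∀ η > 0, ∀ n₀ : ℕ, ∀ τ ≥ 0,
        (0 < τ ∨ ∃ a b : ℕ, 2 ≤ a ∧ 2 ≤ b ∧
          Real.log a / MAC.cap₁ W = Real.log b / MAC.cap₂ W) →
        MAC.pentagonOuterRegion W d₁ d₂ ⊆
          closure {R | R ∈ MAC.achievableBy W (MAC.alternatingCodes W d₁ d₂ η τ n₀)
            (R.1 / MAC.cap₁ W) (R.2 / MAC.cap₂ W)}) ∧
      (d₁ < MAC.cap₁ W → ¬ Convex ℝ (MAC.pentagonOuterRegion W d₁ d₂))) := by
  refine ⟨fun r hr => ⟨fun η hη n₀ => MAC.outerRegion_subset₁ W hr.1 hr.2 hη n₀,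
      MAC.outerRegion_subset_achievableRegion₁ W hr.1 hr.2⟩,
    fun r hr => ⟨fun η hη n₀ => MAC.outerRegion_subset₂ W hr.1 hr.2 hη n₀,
      MAC.outerRegion_subset_achievableRegion₂ W hr.1 hr.2⟩,
    fun d₁ d₂ hC₁ hC₂ hpent => ⟨fun η hη n₀ τ hτ hpow =>
      MAC.pentagonOuterRegion_subset W hC₁ hC₂ hpent hη hτ n₀ hpow,
      MAC.not_convex_pentagonOuterRegion W hC₁ hC₂ hpent⟩⟩
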